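/- Let $V$ be a right quaternionic Hilbert space, i.e. a right vector space over the quaternions $\mathbb H$ with an $\mathbb H$-valued inner product $\langle\cdot,\cdot\rangle$ that is right linear in its second argument, complete for the norm $\|x\|=\langle x,x\rangle^{1/2}$. Fix a Hilbert basis $(\varphi_k)_k$ of $V$ and let $ax:=\sum_k\varphi_k\,a\,\langle\varphi_k,x\rangle$ ($a\in\mathbb H$, $x\in V$) be the left scalar multiplication it induces. Let $\mathcal B(V)$ be the set of bounded right linear operators on $V$, let $I_V$ be the identity, and for $S\in\mathcal B(V)$ and $a\in\mathbb H$ let $Sa$ and $aI_V$ be the operators $x\mapsto S(ax)$ and $x\mapsto ax$. For $q\in\mathbb H$ put $\mathbb S=\{J\in\mathbb H:\operatorname{Re}J=0,\ \overline{J}J=1\}$, $[q]=\operatorname{Re}(q)+\mathbb S\,|\operatorname{Im}(q)|$, and $[\Omega]=\bigcup_{p\in\Omega}[p]$ for $\Omega\subset\mathbb H$. For a bounded right linear operator $T$ (on $V$ or on a subspace of $V$) put $\mathcal Q_q(T)=T^2-2\operatorname{Re}(q)T+|q|^2 I$, with $I$ the identity; the $S$-spectrum $\sigma_S(T)$ is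 the set of $q\in\mathbb H$ for which $\mathcal Q_q(T)$ has no bounded right linear inverse. Let $\sigma_d^S(T)$ be the set of $S$-eigenvalues of finite type of $T\in\mathcal B(V)$: the $q\in\sigma_S(T)$ for which $V$ is a direct sum of $T$-invariant right linear subspaces $V_1,V_2$ with $\dim V_1<\infty$, $\sigma_S(T|_{V_1})\cap\sigma_S(T|_{V_2})=\emptyset$ and $\sigma_S(T|_{V_1})=[q]$. Call $r>0$ admissible (for $T$ and $q$) if $[\overline{B}(q,r)]\cap\sigma_S(T)=[q]$, where $\overline B(q,r)$ is the closed ball, and, when $q\notin\mathbb R$, also $r<|\operatorname{Im}(q)|$. For an admissible $r$ and $J\in\mathbb S$, the Riesz projection of $T$ associated with $[q]$ is $$P_{[q]}=\frac1{2\pi}\int_{\partial([B(q,r)]\cap\mathbb C_J)}S_L^{-1}(p,T)\,dp_J,\qquad S_L^{-1}(p,T)=-\mathcal Q_p(T)^{-1}(T-\overline p\,I_V),\quad dp_J=-dp\,J,$$ where $\mathbb C_J=\mathbb R+J\mathbb R$ and the boundary is positively oriented: it is the union of the circles of radius $r$ in $\mathbb C_J$ centred at the points $\operatorname{Re}(q)\pm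 J|\operatorname{Im}(q)|$ (one circle if $q\in\mathbb R$). **Proposition.** Let $T\in\mathcal B(V)$ and $q\in\sigma_d^S(T)$. Then admissible $r$ exist, and for every admissible $r$, every $J\in\mathbb S$ and every $x\in V$, $$x\in R(P_{[q]})\iff\lim_{n\to\infty}\|\mathcal Q_q(T)^n x\|^{1/n}=0 .$$ -/

import Mathlib

open Filter Topology MulOpposite
open scoped Quaternion

noncomputable section

/-! ### Right quaternionic Hilbert spaces

A right quaternionic vector space is a module over `ℍᵐᵒᵖ`, the vector `x q` being `op q • x`. -/

/-- A quaternion-valued inner product on a right quaternionic vector space, inducing the norm. It is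
right linear in its second argument. A right quaternionic Hilbert space is a complete such space. -/
class RightQuaternionicInner (V : Type*) [NormedAddCommGroup V] [Module ℍᵐᵒᵖ V]
    extends Inner ℍ V where
  inner_add_right : ∀ x y z : V, inner x (y + z) = inner x y + inner x z
  inner_smul_right : ∀ (x y : V) (q : ℍ), inner x (op q • y) = inner x y * q
  star_inner : ∀ x y : V, star (inner x y) = inner y x
  inner_self : ∀ x : V, inner x x = ((‖x‖ ^ 2 : ℝ) : ℍ)

/-- A Hilbert basis: an orthonormal family `φ` such that
`⟪x, y⟫ = ∑ k, ⟪x, φ k⟫ ⟪φ k, y⟫` for all `x`, `y`. -/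
structure QuaternionicHilbertBasis (ι V : Type*) [NormedAddCommGroup V] [Module ℍᵐᵒᵖ V]
    [RightQuaternionicInner V] where
  φ : ι → V
  norm_eq_one : ∀ k, ‖φ k‖ = 1
  inner_eq_zero : ∀ k l, k ≠ l → inner ℍ (φ k) (φ l) = 0
  hasSum_inner : ∀ x y : V,
    HasSum (fun k => inner ℍ x (φ k) * inner ℍ (φ k) y) (inner ℍ x y)

namespace RightQuaternionicInner

variable {V : Type*} [NormedAddCommGroup V] [Module ℍᵐᵒᵖ V] [RightQuaternionicInner V]

theorem inner_add_left (x y z : V) : inner ℍ (x + y) z = inner ℍ x z + inner ℍ y z := by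
  rw [← star_inner z (x + y), inner_add_right, star_add, star_inner, star_inner]

theorem inner_smul_left (x y : V) (q : ℍ) : inner ℍ (op q • x) y = star q * inner ℍ x y := by
  rw [← star_inner y (op q • x), inner_smul_right, star_mul, star_inner]

theorem inner_zero_right (x : V) : inner ℍ x (0 : V) = 0 := by
  simpa using inner_add_right x (0 : V) 0

theorem inner_sum_right {ι : Type*} (x : V) (s : Finset ι) (f : ι → V) :
    inner ℍ x (∑ k ∈ s, f k) = ∑ k ∈ s, inner ℍ x (f k) := by
  classical
  induction s using Finset.induction_on with
  | empty => simp [inner_zero_right]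
  | insert a s ha ih => rw [Finset.sum_insert ha, Finset.sum_insert ha, inner_add_right, ih]

theorem norm_op_smul (x : V) (q : ℍ) : ‖op q • x‖ = ‖x‖ * ‖q‖ := by
  have h : ((‖op q • x‖ ^ 2 : ℝ) : ℍ) = (((‖x‖ * ‖q‖) ^ 2 : ℝ) : ℍ) := by
    rw [← inner_self, inner_smul_right, inner_smul_left, inner_self]
    rw [mul_assoc, Quaternion.coe_commutes, ← mul_assoc, Quaternion.star_mul_self,
      Quaternion.normSq_eq_norm_mul_self]
    rw [← Quaternion.coe_mul]
    congr 1
    ring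
  have h2 := Quaternion.coe_injective h
  exact (pow_left_inj₀ (norm_nonneg _) (by positivity) two_ne_zero).1 h2

theorem norm_add_sq_of_inner_eq_zero {x y : V} (h : inner ℍ x y = 0) :
    ‖x + y‖ ^ 2 = ‖x‖ ^ 2 + ‖y‖ ^ 2 := by
  have h' : inner ℍ y x = 0 := by rw [← star_inner, h, star_zero]
  have : ((‖x + y‖ ^ 2 : ℝ) : ℍ) = ((‖x‖ ^ 2 + ‖y‖ ^ 2 : ℝ) : ℍ) := by
    rw [← inner_self, inner_add_right, inner_add_left, inner_add_left, h, h', inner_self,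
      inner_self, Quaternion.coe_add]
    simp
  exact Quaternion.coe_injective this

end RightQuaternionicInner

namespace QuaternionicHilbertBasis

variable {ι V : Type*} [NormedAddCommGroup V] [Module ℍᵐᵒᵖ V] [RightQuaternionicInner V]
  (b : QuaternionicHilbertBasis ι V)

theorem norm_sum_sq (s : Finset ι) (c : ι → ℍ) :
    ‖∑ k ∈ s, op (c k) • b.φ k‖ ^ 2 = ∑ k ∈ s, ‖c k‖ ^ 2 := by
  classical
  induction s using Finset.induction_on with
  | empty => simp
  | insert a s ha ih =>
    rw [Finset.sum_insert ha, Finset.sum_insert ha, RightQuaternionicInner.norm_add_sq_of_inner_eq_zero, ih,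
      RightQuaternionicInner.norm_op_smul, b.norm_eq_one, one_mul]
    rw [RightQuaternionicInner.inner_sum_right]
    refine Finset.sum_eq_zero fun k hk => ?_
    rw [RightQuaternionicInner.inner_smul_right, RightQuaternionicInner.inner_smul_left, b.inner_eq_zero a k (fun h => ha (h ▸ hk))]
    simp

theorem hasSum_norm_sq (x : V) : HasSum (fun k => ‖inner ℍ (b.φ k) x‖ ^ 2) (‖x‖ ^ 2) := by
  have h := b.hasSum_inner x x
  rw [RightQuaternionicInner.inner_self] at h
  rw [← Quaternion.hasSum_coe]
  convert h using 2 with k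
  rw [← RightQuaternionicInner.star_inner (b.φ k) x, Quaternion.star_mul_self, Quaternion.normSq_eq_norm_mul_self, sq]

theorem sum_norm_sq_le (s : Finset ι) (q : ℍ) (x : V) :
    ∑ k ∈ s, ‖q * inner ℍ (b.φ k) x‖ ^ 2 ≤ (‖q‖ * ‖x‖) ^ 2 := by
  simp only [norm_mul, mul_pow, ← Finset.mul_sum]
  exact mul_le_mul_of_nonneg_left
    (sum_le_hasSum s (fun _ _ => by positivity) (b.hasSum_norm_sq x)) (by positivity)

theorem continuous_op_smul (q : ℍ) : Continuous fun x : V => op q • x :=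
  AddMonoidHomClass.continuous_of_bound (DistribSMul.toAddMonoidHom V (op q)) ‖q‖
    fun x => by simp [RightQuaternionicInner.norm_op_smul, mul_comm]

variable [CompleteSpace V]

theorem summable_leftMul (q : ℍ) (x : V) :
    Summable fun k => op (q * inner ℍ (b.φ k) x) • b.φ k := by
  rw [summable_iff_vanishing_norm]
  intro ε hε
  have hs : Summable fun k => ‖q * inner ℍ (b.φ k) x‖ ^ 2 := by
    simp only [norm_mul, mul_pow]
    exact (b.hasSum_norm_sq x).summable.mul_left _
  obtain ⟨s, h⟩ := summable_iff_vanishing_norm.1 hs (ε ^ 2) (by positivity)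
  refine ⟨s, fun t ht => ?_⟩
  have h1 := h t ht
  rw [← b.norm_sum_sq t fun k => q * inner ℍ (b.φ k) x, Real.norm_of_nonneg (by positivity)] at h1
  exact lt_of_pow_lt_pow_left₀ 2 hε.le h1

theorem norm_leftMul_le (q : ℍ) (x : V) :
    ‖∑' k, op (q * inner ℍ (b.φ k) x) • b.φ k‖ ≤ ‖q‖ * ‖x‖ := by
  refine le_of_tendsto (b.summable_leftMul q x).hasSum.norm (Eventually.of_forall fun s => ?_)
  refine (pow_le_pow_iff_left₀ (norm_nonneg _) (by positivity) two_ne_zero).1 ?_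
  rw [b.norm_sum_sq s fun k => q * inner ℍ (b.φ k) x]
  exact b.sum_norm_sq_le s q x

/-- The left scalar multiplication `q x = ∑ k, φ k q ⟪φ k, x⟫` induced by a Hilbert basis, as a
bounded right linear operator `x ↦ q x`. -/
def leftMul (q : ℍ) : V →L[ℍᵐᵒᵖ] V where
  toFun x := ∑' k, op (q * inner ℍ (b.φ k) x) • b.φ k
  map_add' x y := by
    rw [← (b.summable_leftMul q x).tsum_add (b.summable_leftMul q y)]
    simp only [RightQuaternionicInner.inner_add_right, mul_add, op_add, add_smul]
  map_smul' p x := by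
    obtain ⟨p, rfl⟩ := op_surjective p
    have h := (b.summable_leftMul q x).hasSum.map
      (DistribSMul.toAddMonoidHom V (op p)) (continuous_op_smul p)
    have h2 := h.tsum_eq
    simp only [DistribSMul.toAddMonoidHom_apply] at h2
    rw [RingHom.id_apply, ← h2]
    refine tsum_congr fun k => ?_
    rw [RightQuaternionicInner.inner_smul_right, ← mul_assoc, op_mul, mul_smul]
    rfl
  cont := by
    refine AddMonoidHomClass.continuous_of_bound (AddMonoidHom.mk' (fun x : V =>
      ∑' k, op (q * inner ℍ (b.φ k) x) • b.φ k) fun x y => ?_) ‖q‖ fun x => b.norm_leftMul_le q x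
    rw [← (b.summable_leftMul q x).tsum_add (b.summable_leftMul q y)]
    simp only [RightQuaternionicInner.inner_add_right, mul_add, op_add, add_smul]

end QuaternionicHilbertBasis

/-! ### Spheres and axially symmetric hulls -/

/-- The sphere `𝕊` of imaginary units. -/
def imaginaryUnits : Set ℍ := {J | J.re = 0 ∧ star J * J = 1}

/-- The sphere `[q] = Re q + 𝕊 |Im q|`. -/
def quaternionSphere (q : ℍ) : Set ℍ :=
  {p | ∃ J ∈ imaginaryUnits, p = (q.re : ℍ) + J * (‖q.im‖ : ℍ)}

/-- The axially symmetric hull `[Ω] = ⋃ p ∈ Ω, [p]`. -/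
def axialHull (Ω : Set ℍ) : Set ℍ := ⋃ p ∈ Ω, quaternionSphere p

/-! ### The `S`-spectrum -/

section Spectrum

variable {V : Type*} [NormedAddCommGroup V] [NormedSpace ℝ V] [Module ℍᵐᵒᵖ V]
  [IsScalarTower ℝ ℍᵐᵒᵖ V]

/-- `Q_q(T) = T² - 2 Re(q) T + |q|² I`. -/
def pseudoResolventPoly (T : V →L[ℍᵐᵒᵖ] V) (q : ℍ) : V →L[ℍᵐᵒᵖ] V :=
  T ^ 2 - (2 * q.re) • T + (‖q‖ ^ 2) • (1 : V →L[ℍᵐᵒᵖ] V)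

/-- The `S`-spectrum: the `q` for which `Q_q(T)` is not invertible in `B(V)`. -/
def sSpectrum (T : V →L[ℍᵐᵒᵖ] V) : Set ℍ := {q | ¬ IsUnit (pseudoResolventPoly T q)}

/-- `q` is an `S`-eigenvalue of finite type of `T`: `V` is the direct sum of `T`-invariant subspaces
`V₁`, `V₂` with `V₁` finite dimensional, such that the restrictions of `T` have disjoint `S`-spectra
and the `S`-spectrum of the restriction to `V₁` is `[q]`. -/
def IsSEigenvalueOfFiniteType (T : V →L[ℍᵐᵒᵖ] V) (q : ℍ) : Prop :=
  q ∈ sSpectrum T ∧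
  ∃ (V₁ V₂ : Submodule ℍᵐᵒᵖ V) (h₁ : Set.MapsTo T V₁ V₁) (h₂ : Set.MapsTo T V₂ V₂),
    IsCompl V₁ V₂ ∧ Module.Finite ℍᵐᵒᵖ V₁ ∧
    sSpectrum (T.restrict h₁) ∩ sSpectrum (T.restrict h₂) = ∅ ∧
    sSpectrum (T.restrict h₁) = quaternionSphere q

/-- The discrete `S`-spectrum `σ_d^S(T)`. -/
def discreteSSpectrum (T : V →L[ℍᵐᵒᵖ] V) : Set ℍ := {q | IsSEigenvalueOfFiniteType T q}

/-- `r` is admissible for `[q]`: the closed `r`-neighbourhood of `[q]` meets the `S`-spectrum in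
`[q]` only and, if `q` is not real, it meets each slice `ℂ_I` in two disjoint discs. -/
def IsAdmissibleRadius (T : V →L[ℍᵐᵒᵖ] V) (q : ℍ) (r : ℝ) : Prop :=
  0 < r ∧ axialHull (Metric.closedBall q r) ∩ sSpectrum T = quaternionSphere q ∧
    (q.im ≠ 0 → r < ‖q.im‖)

end Spectrum

/-! ### The Riesz projection -/

section Riesz

variable {ι V : Type*} [NormedAddCommGroup V] [NormedSpace ℝ V] [Module ℍᵐᵒᵖ V]
  [IsScalarTower ℝ ℍᵐᵒᵖ V] [RightQuaternionicInner V] [CompleteSpace V]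

/-- The left `S`-resolvent operator `-Q_p(T)⁻¹ (T - p̄ I)`, used for `p` outside the
`S`-spectrum. -/
def leftSResolvent (b : QuaternionicHilbertBasis ι V) (T : V →L[ℍᵐᵒᵖ] V) (p : ℍ) :
    V →L[ℍᵐᵒᵖ] V :=
  -(Ring.inverse (pseudoResolventPoly T p) * (T - b.leftMul (star p)))

/-- The identification `u + i v ↦ u + I v` of `ℂ` with the slice `ℂ_I`. -/
def toSlice (I : ℍ) (z : ℂ) : ℍ := (z.re : ℍ) + I * (z.im : ℍ)

/-- `∫ S_L⁻¹(p, T) dp_I`, with `dp_I = -dp I`, over the positively oriented circle in `ℂ_I` with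
centre `c` and radius `r`. An operator is multiplied on the right by a quaternion `a` by composing
it with `x ↦ a x`. The integral is taken in the Banach space of bounded real linear operators. -/
def circleSResolventIntegral (b : QuaternionicHilbertBasis ι V) (T : V →L[ℍᵐᵒᵖ] V) (I : ℍ)
    (c : ℂ) (r : ℝ) : V →L[ℝ] V :=
  ∫ θ in (0 : ℝ)..(2 * Real.pi),
    (leftSResolvent b T (toSlice I (circleMap c r θ)) *
      b.leftMul (-(toSlice I (deriv (circleMap c r) θ) * I))).restrictScalars ℝ

/-- The Riesz projection `P_[q] = (1 / 2π) ∫ S_L⁻¹(p, T) dp_I`, the integral being taken over the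
boundary of `Ω ∩ ℂ_I`, where `Ω` is the open `r`-neighbourhood of `[q]`. For an admissible `r`, the
set `Ω ∩ ℂ_I` consists of the discs of radius `r` about the points of `[q] ∩ ℂ_I`, namely
`Re q + I |Im q|` and `Re q - I |Im q|`, which are one point if `q` is real. -/
def rieszProjection (b : QuaternionicHilbertBasis ι V) (T : V →L[ℍᵐᵒᵖ] V) (q I : ℍ) (r : ℝ) :
    V →L[ℝ] V :=
  (1 / (2 * Real.pi)) •
    ∑ c ∈ ({⟨q.re, ‖q.im‖⟩, ⟨q.re, -‖q.im‖⟩} : Finset ℂ), circleSResolventIntegral b T I c r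

end Riesz

end

open scoped ComplexConjugate

/-! ### The Riesz integral of a bounded operator on a complex Banach space -/

section ComplexRiesz

/-! Let `V = V₁ ⊕ V₂` be the decomposition given by `q ∈ discreteSSpectrum T`. Both sides of the
equivalence turn out to say `x ∈ V₁`.

Right multiplication by `ℂ ⊂ ℍ` makes `V` a complex Banach space on which `T` is `ℂ`-linear, and
`Q_z(T) = (T - z)(T - z̄)` for complex `z`. On the finite-dimensional `V₁` the eigenvalues of `T`
lie in `[q] ∩ ℂ = {Re q ± i|Im q|}`, so some power of `Q_q(T)` kills each vector of `V₁`. On `V₂`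
the operator `Q_q(T)` has a bounded inverse, so its powers shrink a vector at most geometrically.
Hence the root limit vanishes exactly on `V₁` (`tendsto_norm_pow_rpow_zero_iff`), and `V₂` is
closed.

In the Riesz integral, separate the part of the kernel without the imaginary unit from the part with
it. The contour is invariant under conjugation, which cancels the latter. The same cancellation
occurs in the complex resolvent integral, where right multiplication by `i` replaces left
multiplication by `J`. So `2πi P` is the sum of the contour integrals of the complex resolvent of
`T` (`I_smul_rieszProjection_apply`). By residues it is `2πi` on generalised eigenvectors, which
span `V₁`; by Cauchy's theorem it is `0` on `V₂`. Thus `P` projects onto `V₁` along `V₂`. -/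

theorem circleIntegral_sub_zpow_center (c : ℂ) {r : ℝ} (hr : 0 < r) (k : ℕ) :
    (∮ z in C(c, r), (z - c) ^ (-(k + 1) : ℤ)) = if k = 0 then 2 * Real.pi * Complex.I else 0 := by
  split_ifs with hk
  · subst hk
    simpa using circleIntegral.integral_sub_center_inv c hr.ne'
  · exact circleIntegral.integral_sub_zpow_of_ne (by omega) c c r

theorem circleIntegral_sub_zpow_of_notMem {c c₀ : ℂ} {r : ℝ} (hr : 0 < r)
    (hc : c₀ ∉ Metric.closedBall c r) (n : ℤ) :
    (∮ z in C(c, r), (z - c₀) ^ n) = 0 := by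
  have hd : ∀ z ∈ Metric.closedBall c r, DifferentiableAt ℂ (fun z : ℂ => (z - c₀) ^ n) z := by
    intro z hz
    refine DifferentiableAt.zpow (by fun_prop) (Or.inl ?_)
    exact sub_ne_zero.2 fun h => hc (h ▸ hz)
  exact Complex.circleIntegral_eq_zero_of_differentiable_on_off_countable hr.le
    Set.countable_empty (fun z hz => (hd z hz).continuousAt.continuousWithinAt)
    fun z hz => hd z (Metric.ball_subset_closedBall hz.1)

variable {E : Type*} [NormedAddCommGroup E] [NormedSpace ℂ E]

theorem resolvent_apply_of_sub_eq {T : E →L[ℂ] E} {z : ℂ} (hz : z ∈ resolventSet ℂ T) {x y : E}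
    (h : z • y - T y = x) : resolvent T z x = y := by
  have h1 : resolvent T z * (algebraMap ℂ (E →L[ℂ] E) z - T) = 1 :=
    Ring.inverse_mul_cancel _ hz
  have h2 := congrArg (fun S : E →L[ℂ] E => S y) h1
  rw [← h]
  simpa [Algebra.algebraMap_eq_smul_one] using h2

/-- A truncated Neumann series in `(T - c) / (z - c)` telescopes. If `(T - c)^N x = 0` the error
term vanishes and the sum is the resolvent applied to `x`. -/
theorem smul_sub_sum_zpow_smul (T : E →L[ℂ] E) {c z : ℂ} (hz : z ≠ c) (x : E) (N : ℕ) :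
    z • (∑ k ∈ Finset.range N,
        (z - c) ^ (-(k + 1) : ℤ) • ((T - algebraMap ℂ (E →L[ℂ] E) c) ^ k) x) -
      T (∑ k ∈ Finset.range N,
        (z - c) ^ (-(k + 1) : ℤ) • ((T - algebraMap ℂ (E →L[ℂ] E) c) ^ k) x) =
    x - (z - c) ^ (-N : ℤ) • ((T - algebraMap ℂ (E →L[ℂ] E) c) ^ N) x := by
  induction N with
  | zero => simp
  | succ N ih =>
    rw [Finset.sum_range_succ, smul_add, map_add, add_sub_add_comm, ih]
    have hne : z - c ≠ 0 := sub_ne_zero.2 hz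
    have h1 : T (((T - algebraMap ℂ (E →L[ℂ] E) c) ^ N) x) =
        ((T - algebraMap ℂ (E →L[ℂ] E) c) ^ (N + 1)) x +
          c • ((T - algebraMap ℂ (E →L[ℂ] E) c) ^ N) x := by
      rw [pow_succ']
      simp [Algebra.algebraMap_eq_smul_one]
    have h2 : (z - c) ^ (-N : ℤ) = (z - c) ^ (-(N + 1) : ℤ) * (z - c) := by
      rw [← zpow_add_one₀ hne]
      congr 1
      ring
    rw [map_smul, h1, h2]
    push_cast
    module

variable [CompleteSpace E]

theorem differentiableAt_resolvent_apply {T : E →L[ℂ] E} {z : ℂ} (hz : z ∈ resolventSet ℂ T)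
    (x : E) : DifferentiableAt ℂ (fun z => resolvent T z x) z :=
  (ContinuousLinearMap.apply ℂ E x).differentiableAt.comp z
    (spectrum.hasDerivAt_resolvent_const_left hz).differentiableAt

theorem circleIntegral_resolvent_of_pow_eq_zero {T : E →L[ℂ] E} {c c₀ : ℂ} {r : ℝ} (hr : 0 < r)
    (hs : Metric.sphere c r ⊆ resolventSet ℂ T) (hc : c₀ ∉ Metric.sphere c r) {N : ℕ} {x : E}
    (hx : ((T - algebraMap ℂ (E →L[ℂ] E) c₀) ^ N) x = 0) :
    (∮ z in C(c, r), resolvent T z x) = ∑ k ∈ Finset.range N,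
      (∮ z in C(c, r), (z - c₀) ^ (-(k + 1) : ℤ)) •
        ((T - algebraMap ℂ (E →L[ℂ] E) c₀) ^ k) x := by
  have hne : ∀ z ∈ Metric.sphere c r, z ≠ c₀ := fun z hz h => hc (h ▸ hz)
  rw [circleIntegral.integral_congr hr.le (g := fun z => ∑ k ∈ Finset.range N,
      (z - c₀) ^ (-(k + 1) : ℤ) • ((T - algebraMap ℂ (E →L[ℂ] E) c₀) ^ k) x)]
  · rw [circleIntegral.integral_fun_sum]
    · exact Finset.sum_congr rfl fun k _ => circleIntegral.integral_smul_const _ _ _ _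
    · intro k _
      refine ContinuousOn.circleIntegrable hr.le ?_
      refine ContinuousOn.smul (ContinuousOn.zpow₀ (by fun_prop) _ fun z hz => ?_)
        continuousOn_const
      exact Or.inl (sub_ne_zero.2 (hne z hz))
  · intro z hz
    refine resolvent_apply_of_sub_eq (hs hz) ?_
    rw [smul_sub_sum_zpow_smul T (hne z hz), hx, smul_zero, sub_zero]

theorem sum_circleIntegral_resolvent_of_pow_eq_zero {T : E →L[ℂ] E} {s : Finset ℂ} {r : ℝ}
    (hr : 0 < r) (hs : ∀ c ∈ s, Metric.sphere c r ⊆ resolventSet ℂ T)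
    (hsep : ∀ c ∈ s, ∀ d ∈ s, d ≠ c → d ∉ Metric.closedBall c r) {c₀ : ℂ} (hc₀ : c₀ ∈ s) {N : ℕ}
    {x : E} (hx : ((T - algebraMap ℂ (E →L[ℂ] E) c₀) ^ N) x = 0) :
    ∑ c ∈ s, (∮ z in C(c, r), resolvent T z x) = (2 * Real.pi * Complex.I : ℂ) • x := by
  -- With `N + 1` in place of `N` the index `k = 0`, which carries the residue, is present even when
  -- `N = 0`.
  have hx' : ((T - algebraMap ℂ (E →L[ℂ] E) c₀) ^ (N + 1)) x = 0 := by
    rw [pow_succ']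
    simp [hx]
  rw [Finset.sum_eq_single c₀]
  · rw [circleIntegral_resolvent_of_pow_eq_zero hr (hs c₀ hc₀) _ hx', Finset.sum_eq_single 0]
    · rw [circleIntegral_sub_zpow_center c₀ hr]
      simp
    · intro k _ hk
      rw [circleIntegral_sub_zpow_center c₀ hr, if_neg hk, zero_smul]
    · simp
    · simpa using hr.ne
  · intro c hc hcc
    have hn := hsep c hc c₀ hc₀ hcc.symm
    rw [circleIntegral_resolvent_of_pow_eq_zero hr (hs c hc)
      (fun h => hn (Metric.sphere_subset_closedBall h)) hx']
    refine Finset.sum_eq_zero fun k _ => ?_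
    rw [circleIntegral_sub_zpow_of_notMem hr hn, zero_smul]
  · exact fun h => absurd hc₀ h

/-- Closedness makes `W` a Banach space, so bijectivity of `z - T` on `W` gives a resolvent of the
restriction that is holomorphic on the whole disc. It agrees with that of `T` on the circle, and
Cauchy's theorem applies. -/
theorem circleIntegral_resolvent_eq_zero {T : E →L[ℂ] E} {W : Submodule ℂ E}
    (hW : IsClosed (W : Set E)) (hT : ∀ x ∈ W, T x ∈ W) {c : ℂ} {r : ℝ} (hr : 0 < r)
    (hs : Metric.sphere c r ⊆ resolventSet ℂ T)
    (hinj : ∀ z ∈ Metric.closedBall c r, ∀ x ∈ W, z • x - T x = 0 → x = 0)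
    (hsurj : ∀ z ∈ Metric.closedBall c r, ∀ y ∈ W, ∃ x ∈ W, z • x - T x = y) {x : E}
    (hx : x ∈ W) : (∮ z in C(c, r), resolvent T z x) = 0 := by
  have : CompleteSpace W := hW.completeSpace_coe
  obtain ⟨S, hS⟩ : ∃ S : W →L[ℂ] W, ∀ y, (S y : E) = T y := ⟨T.restrict hT, fun _ => rfl⟩
  have hcoe : ∀ z (y : W), (((algebraMap ℂ (W →L[ℂ] W) z - S) y : W) : E) = z • (y : E) - T y := by
    intro z y
    simp [Algebra.algebraMap_eq_smul_one, hS]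
  have hres : Metric.closedBall c r ⊆ resolventSet ℂ S := by
    intro z hz
    refine ContinuousLinearMap.isUnit_iff_bijective.2 ⟨?_, fun y => ?_⟩
    · refine (injective_iff_map_eq_zero _).2 fun y hy => ?_
      have := hcoe z y
      rw [hy, Submodule.coe_zero] at this
      exact Subtype.ext (hinj z hz y y.2 this.symm)
    · obtain ⟨u, hu, h⟩ := hsurj z hz y y.2
      exact ⟨⟨u, hu⟩, Subtype.ext ((hcoe z ⟨u, hu⟩).trans h)⟩
  have hd : ∀ z ∈ Metric.closedBall c r,
      DifferentiableAt ℂ (fun z => W.subtypeL (resolvent S z ⟨x, hx⟩)) z := fun z hz =>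
    W.subtypeL.differentiableAt.comp z
      (differentiableAt_resolvent_apply (T := S) (hres hz) ⟨x, hx⟩)
  rw [circleIntegral.integral_congr hr.le (g := fun z => W.subtypeL (resolvent S z ⟨x, hx⟩))]
  · exact Complex.circleIntegral_eq_zero_of_differentiable_on_off_countable hr.le
      Set.countable_empty (fun z hz => (hd z hz).continuousAt.continuousWithinAt)
      fun z hz => hd z (Metric.ball_subset_closedBall hz.1)
  · intro z hz
    refine resolvent_apply_of_sub_eq (hs hz) ?_
    change z • ((resolvent S z ⟨x, hx⟩ : W) : E) - T (resolvent S z ⟨x, hx⟩ : W) = x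
    rw [← hcoe]
    have h1 : (algebraMap ℂ (W →L[ℂ] W) z - S) * resolvent S z = 1 :=
      Ring.mul_inverse_cancel _ (hres (Metric.sphere_subset_closedBall hz))
    exact congrArg (fun A : W →L[ℂ] W => ((A ⟨x, hx⟩ : W) : E)) h1

/-- Over `ℂ` a finite-dimensional space is the sum of the generalised eigenspaces of an
endomorphism, and those of non-eigenvalues are zero. So an additive property need only be checked on
generalised eigenvectors. -/
theorem genEigenvector_induction {E : Type*} [NormedAddCommGroup E] [NormedSpace ℂ E]
    {T : E →L[ℂ] E} {W : Submodule ℂ E} [FiniteDimensional ℂ W] (hT : ∀ x ∈ W, T x ∈ W) {s : Set ℂ}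
    (hs : ∀ c, ∀ x ∈ W, T x = c • x → x ≠ 0 → c ∈ s) {p : E → Prop} (zero : p 0)
    (add : ∀ x y, p x → p y → p (x + y))
    (gen : ∀ c ∈ s, ∀ (N : ℕ) (x : E), ((T - algebraMap ℂ (E →L[ℂ] E) c) ^ N) x = 0 → p x)
    {x : E} (hx : x ∈ W) : p x := by
  let S : Module.End ℂ W := (T : E →ₗ[ℂ] E).restrict hT
  have hcoe : ∀ (c : ℂ) (N : ℕ) (y : W), ((((S - c • 1) ^ N) y : W) : E) =
      ((T - algebraMap ℂ (E →L[ℂ] E) c) ^ N) y := by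
    intro c N
    induction N with
    | zero => simp
    | succ N ih =>
      intro y
      rw [pow_succ, pow_succ, Module.End.mul_apply, ih, mul_apply_eq_comp]
      simp [S, Algebra.algebraMap_eq_smul_one]
  have hmem : (⟨x, hx⟩ : W) ∈ ⨆ c, S.maxGenEigenspace c := by
    rw [Module.End.iSup_maxGenEigenspace_eq_top]
    trivial
  refine Submodule.iSup_induction _ (motive := fun y : W => p y) hmem (fun c y hy => ?_) zero
    fun y z => add y z
  by_cases hc : c ∈ s
  · obtain ⟨N, hN⟩ := (Module.End.mem_maxGenEigenspace S c y).1 hy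
    exact gen c hc N y (by rw [← hcoe, hN, Submodule.coe_zero])
  · have hev : ¬ S.HasEigenvalue c := by
      intro h
      obtain ⟨v, hv⟩ := h.exists_hasEigenvector
      refine hc (hs c v v.2 ?_ fun h0 => hv.2 (Subtype.ext h0))
      exact congrArg Subtype.val hv.apply_eq_smul
    have hbot : S.maxGenEigenspace c = ⊥ := by
      by_contra hne
      obtain ⟨k, hk⟩ : ∃ k, S.genEigenspace c (k : ℕ) ≠ ⊥ := by
        by_contra! hall
        refine hne ?_
        rw [eq_bot_iff]
        intro v hv
        obtain ⟨k, hk⟩ := (Module.End.mem_maxGenEigenspace S c v).1 hv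
        rw [← hall k, Module.End.mem_genEigenspace_nat]
        exact hk
      exact hev (Module.End.hasEigenvalue_of_hasGenEigenvalue (k := k) hk)
    rw [hbot, Submodule.mem_bot] at hy
    subst hy
    exact zero

end ComplexRiesz

/-! ### Left multiplication by quaternions -/

theorem real_smul_eq_op_smul {V : Type*} [NormedAddCommGroup V] [NormedSpace ℝ V]
    [Module ℍᵐᵒᵖ V] [IsScalarTower ℝ ℍᵐᵒᵖ V] (r : ℝ) (x : V) : r • x = op (r : ℍ) • x := by
  rw [← one_smul ℍᵐᵒᵖ x, ← smul_assoc, one_smul]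
  congr 1
  apply unop_injective
  ext <;> simp

namespace QuaternionicHilbertBasis

variable {ι V : Type*} [NormedAddCommGroup V] [Module ℍᵐᵒᵖ V] [RightQuaternionicInner V]
  (b : QuaternionicHilbertBasis ι V)

theorem norm_inner_le (k : ι) (x : V) : ‖inner ℍ (b.φ k) x‖ ≤ ‖x‖ := by
  have h := sum_le_hasSum {k} (fun _ _ => by positivity) (b.hasSum_norm_sq x)
  rw [Finset.sum_singleton] at h
  exact (pow_le_pow_iff_left₀ (norm_nonneg _) (norm_nonneg _) two_ne_zero).1 h

theorem ext_inner {x y : V} (h : ∀ k, inner ℍ (b.φ k) x = inner ℍ (b.φ k) y) : x = y := by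
  have h0 : ∀ k, inner ℍ (b.φ k) (x - y) = 0 := by
    intro k
    have h1 := RightQuaternionicInner.inner_add_right (b.φ k) (x - y) y
    rw [sub_add_cancel, h k] at h1
    simpa using h1
  have h2 := b.hasSum_norm_sq (x - y)
  simp only [h0, norm_zero, ne_eq, OfNat.ofNat_ne_zero, not_false_eq_true, zero_pow] at h2
  have h3 := h2.unique hasSum_zero
  exact sub_eq_zero.1 (norm_eq_zero.1 (pow_eq_zero_iff two_ne_zero |>.1 h3))

variable [CompleteSpace V]

/-- In coordinates `leftMul` multiplies each coefficient on the left; with `ext_inner` this reduces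
its algebraic identities to those of `ℍ`. -/
theorem inner_leftMul (q : ℍ) (x : V) (k : ι) :
    inner ℍ (b.φ k) (b.leftMul q x) = q * inner ℍ (b.φ k) x := by
  let f : V →+ ℍ := AddMonoidHom.mk' (fun x => inner ℍ (b.φ k) x)
    (RightQuaternionicInner.inner_add_right _)
  have hf : Continuous f := AddMonoidHomClass.continuous_of_bound f 1
    fun x => (b.norm_inner_le k x).trans_eq (one_mul _).symm
  have h := (b.summable_leftMul q x).hasSum.map f hf
  have h2 : HasSum (f ∘ fun l => op (q * inner ℍ (b.φ l) x) • b.φ l)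
      (q * inner ℍ (b.φ k) x) := by
    convert hasSum_single (f := f ∘ fun l => op (q * inner ℍ (b.φ l) x) • b.φ l) k ?_ using 1
    · simp only [Function.comp_apply, f, AddMonoidHom.mk'_apply,
        RightQuaternionicInner.inner_smul_right, RightQuaternionicInner.inner_self, b.norm_eq_one]
      simp
    · intro l hl
      simp only [Function.comp_apply, f, AddMonoidHom.mk'_apply,
        RightQuaternionicInner.inner_smul_right, b.inner_eq_zero k l hl.symm, zero_mul]
  exact h.unique h2

theorem leftMul_mul (p q : ℍ) : b.leftMul (p * q) = b.leftMul p * b.leftMul q := by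
  ext x
  refine b.ext_inner fun k => ?_
  rw [mul_apply_eq_comp, inner_leftMul, inner_leftMul, inner_leftMul, mul_assoc]

theorem leftMul_add (p q : ℍ) : b.leftMul (p + q) = b.leftMul p + b.leftMul q := by
  ext x
  refine b.ext_inner fun k => ?_
  rw [add_apply, RightQuaternionicInner.inner_add_right, inner_leftMul,
    inner_leftMul, inner_leftMul, add_mul]

theorem leftMul_coe [NormedSpace ℝ V] [IsScalarTower ℝ ℍᵐᵒᵖ V] (r : ℝ) :
    b.leftMul (r : ℍ) = r • (1 : V →L[ℍᵐᵒᵖ] V) := by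
  ext x
  refine b.ext_inner fun k => ?_
  rw [inner_leftMul]
  simp only [smul_apply, one_apply_eq_self]
  rw [real_smul_eq_op_smul, RightQuaternionicInner.inner_smul_right, Quaternion.coe_commutes]

theorem leftMul_toSlice [NormedSpace ℝ V] [IsScalarTower ℝ ℍᵐᵒᵖ V] (I : ℍ) (z : ℂ) :
    b.leftMul (toSlice I z) = z.re • (1 : V →L[ℍᵐᵒᵖ] V) + z.im • b.leftMul I := by
  rw [toSlice, leftMul_add, leftMul_mul, leftMul_coe, leftMul_coe, mul_smul_comm, mul_one]

end QuaternionicHilbertBasis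

/-! ### Slices -/

section Slices

theorem imaginaryUnits.mul_self {I : ℍ} (hI : I ∈ imaginaryUnits) : I * I = -1 := by
  have h : star I = -I := by
    ext <;> simp [hI.1]
  have h2 := hI.2
  rw [h, neg_mul] at h2
  rw [← h2, neg_neg]

theorem imaginaryUnits.star_eq {I : ℍ} (hI : I ∈ imaginaryUnits) : star I = -I := by
  ext <;> simp [hI.1]

/-- The imaginary unit `i` of the quaternions. -/
noncomputable def quaternionI : ℍ := ⟨0, 1, 0, 0⟩

theorem quaternionI_mem : quaternionI ∈ imaginaryUnits := by
  refine ⟨rfl, ?_⟩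
  rw [Quaternion.star_mul_self, Quaternion.normSq_def']
  simp [quaternionI]

theorem toSlice_mul {I : ℍ} (hI : I ∈ imaginaryUnits) (z w : ℂ) :
    toSlice I (z * w) = toSlice I z * toSlice I w := by
  have h := imaginaryUnits.mul_self hI
  have h1 : (z.im : ℍ) * I = I * (z.im : ℍ) := Quaternion.coe_commutes _ _
  have h2 : (z.re : ℍ) * I = I * (z.re : ℍ) := Quaternion.coe_commutes _ _
  simp only [toSlice, Complex.mul_re, Complex.mul_im, Quaternion.coe_sub, Quaternion.coe_add,
    Quaternion.coe_mul]
  have h3 : I * (z.im : ℍ) * (I * (w.im : ℍ)) = -((z.im : ℍ) * (w.im : ℍ)) := by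
    rw [← mul_assoc, mul_assoc I, h1, ← mul_assoc, h]
    simp
  rw [add_mul (z.re : ℍ), mul_add (z.re : ℍ), mul_add (I * (z.im : ℍ)), h3,
    ← mul_assoc (z.re : ℍ) I, h2]
  noncomm_ring

theorem star_toSlice {I : ℍ} (hI : I ∈ imaginaryUnits) (z : ℂ) :
    star (toSlice I z) = toSlice I (starRingEnd ℂ z) := by
  simp only [toSlice, star_add, star_mul, imaginaryUnits.star_eq hI, Quaternion.star_coe,
    Complex.conj_re, Complex.conj_im, Quaternion.coe_neg, mul_neg, Quaternion.coe_commutes]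

theorem re_toSlice {I : ℍ} (hI : I ∈ imaginaryUnits) (z : ℂ) : (toSlice I z).re = z.re := by
  simp [toSlice, hI.1]

theorem norm_toSlice {I : ℍ} (hI : I ∈ imaginaryUnits) (z : ℂ) : ‖toSlice I z‖ = ‖z‖ := by
  have h : ((‖toSlice I z‖ ^ 2 : ℝ) : ℍ) = ((‖z‖ ^ 2 : ℝ) : ℍ) := by
    rw [sq, ← Quaternion.normSq_eq_norm_mul_self, ← Quaternion.star_mul_self, star_toSlice hI,
      ← toSlice_mul hI, ← Complex.normSq_eq_conj_mul_self, toSlice, Complex.ofReal_re, Complex.ofReal_im,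
      Complex.normSq_eq_norm_sq, Quaternion.coe_zero, mul_zero, add_zero]
  have h2 := Quaternion.coe_injective h
  exact (pow_left_inj₀ (norm_nonneg _) (norm_nonneg _) two_ne_zero).1 h2

theorem norm_sq_eq_re_add_im (q : ℍ) : ‖q‖ ^ 2 = q.re ^ 2 + ‖q.im‖ ^ 2 := by
  rw [sq, sq ‖q.im‖, ← Quaternion.normSq_eq_norm_mul_self, ← Quaternion.normSq_eq_norm_mul_self,
    Quaternion.normSq_def', Quaternion.normSq_def']
  simp
  ring

theorem mem_quaternionSphere_iff {p q : ℍ} :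
    p ∈ quaternionSphere q ↔ p.re = q.re ∧ ‖p.im‖ = ‖q.im‖ := by
  constructor
  · rintro ⟨J, hJ, rfl⟩
    have h : (q.re : ℍ) + J * (‖q.im‖ : ℍ) = toSlice J ⟨q.re, ‖q.im‖⟩ := rfl
    have h1 := re_toSlice hJ ⟨q.re, ‖q.im‖⟩
    have h2 := norm_toSlice hJ ⟨q.re, ‖q.im‖⟩
    rw [h]
    refine ⟨h1, ?_⟩
    have h3 := norm_sq_eq_re_add_im (toSlice J ⟨q.re, ‖q.im‖⟩)
    rw [h1, h2, ← Complex.normSq_eq_norm_sq, Complex.normSq_apply] at h3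
    refine (pow_left_inj₀ (norm_nonneg _) (norm_nonneg _) two_ne_zero).1 ?_
    simp only at h3
    linarith
  · rintro ⟨h1, h2⟩
    by_cases h0 : ‖q.im‖ = 0
    -- For real `q` the unit is multiplied by `0`, so any unit serves; otherwise it is the
    -- normalised imaginary part of `p`.
    · refine ⟨quaternionI, quaternionI_mem, ?_⟩
      rw [h0] at h2 ⊢
      have h3 : p.im = 0 := norm_eq_zero.1 h2
      rw [← Quaternion.re_add_im p, h3, h1, Quaternion.coe_zero, mul_zero]
    · refine ⟨p.im * ((‖q.im‖⁻¹ : ℝ) : ℍ), ⟨?_, ?_⟩, ?_⟩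
      · rw [Quaternion.mul_coe_eq_smul, Quaternion.re_smul, Quaternion.re_im, smul_zero]
      · rw [Quaternion.star_mul_self, Quaternion.normSq_eq_norm_mul_self, norm_mul, h2]
        simp [h0]
      · rw [mul_assoc, ← Quaternion.coe_mul, inv_mul_cancel₀ h0, ← h1]
        simp

theorem mem_quaternionSphere_iff_norm {p q : ℍ} :
    p ∈ quaternionSphere q ↔ p.re = q.re ∧ ‖p‖ = ‖q‖ := by
  rw [mem_quaternionSphere_iff]
  refine and_congr_right fun h => ?_
  rw [← pow_left_inj₀ (norm_nonneg p) (norm_nonneg q) two_ne_zero, norm_sq_eq_re_add_im p,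
    norm_sq_eq_re_add_im q, h, add_right_inj, pow_left_inj₀ (norm_nonneg _) (norm_nonneg _) two_ne_zero]

theorem mem_quaternionSphere_self (q : ℍ) : q ∈ quaternionSphere q :=
  mem_quaternionSphere_iff.2 ⟨rfl, rfl⟩

end Slices

/-! ### Bounded right linear operators and their restrictions -/

section RightLinear

theorem bijective_of_isUnit {V : Type*} [NormedAddCommGroup V] [Module ℍᵐᵒᵖ V]
    {S : V →L[ℍᵐᵒᵖ] V} (h : IsUnit S) :
    Function.Bijective S := by
  obtain ⟨u, rfl⟩ := h
  refine Function.bijective_iff_has_inverse.2 ⟨u⁻¹.1, fun x => ?_, fun x => ?_⟩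
  · rw [← mul_apply_eq_comp, Units.inv_mul]
    rfl
  · rw [← mul_apply_eq_comp, Units.mul_inv]
    rfl

variable {V : Type*} [NormedAddCommGroup V] [NormedSpace ℝ V] [Module ℍᵐᵒᵖ V]
  [IsScalarTower ℝ ℍᵐᵒᵖ V]

theorem pseudoResolventPoly_apply (T : V →L[ℍᵐᵒᵖ] V) (p : ℍ) (x : V) :
    pseudoResolventPoly T p x = T (T x) - (2 * p.re) • T x + (‖p‖ ^ 2) • x := by
  simp [pseudoResolventPoly, sq T]

theorem pseudoResolventPoly_congr (T : V →L[ℍᵐᵒᵖ] V) {p q : ℍ} (hre : p.re = q.re)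
    (hnorm : ‖p‖ = ‖q‖) : pseudoResolventPoly T p = pseudoResolventPoly T q := by
  rw [pseudoResolventPoly, pseudoResolventPoly, hre, hnorm]

theorem mem_sSpectrum_congr {T : V →L[ℍᵐᵒᵖ] V} {p q : ℍ} (h : p ∈ quaternionSphere q) :
    p ∈ sSpectrum T ↔ q ∈ sSpectrum T := by
  have h := mem_quaternionSphere_iff_norm.1 h
  rw [sSpectrum, Set.mem_ofPred_eq, Set.mem_ofPred_eq, pseudoResolventPoly_congr T h.1 h.2]

/-- Restriction of scalars from the quaternions to the reals. -/
noncomputable def realOperator : (V →L[ℍᵐᵒᵖ] V) →* (V →L[ℝ] V) where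
  toFun S := S.restrictScalars ℝ
  map_one' := rfl
  map_mul' _ _ := rfl

theorem realOperator_apply (S : V →L[ℍᵐᵒᵖ] V) (x : V) : realOperator S x = S x := rfl

/-- A real linear inverse of a right linear map is again right linear. Invertibility can therefore
be tested among the bounded real operators, where, for complete `V`, the open mapping theorem,
openness of the units and continuity of inversion are available. -/
theorem isUnit_of_isUnit_realOperator {S : V →L[ℍᵐᵒᵖ] V} (h : IsUnit (realOperator S)) :
    IsUnit S := by
  obtain ⟨u, hu⟩ := h
  have h1 : ∀ x, (u⁻¹.1) (S x) = x := by
    intro x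
    rw [← realOperator_apply, ← hu, ← mul_apply_eq_comp, Units.inv_mul]
    rfl
  have h2 : ∀ x, S (u⁻¹.1 x) = x := by
    intro x
    rw [← realOperator_apply, ← hu, ← mul_apply_eq_comp, Units.mul_inv]
    rfl
  let R : V →L[ℍᵐᵒᵖ] V :=
    { toFun := u⁻¹.1
      map_add' := map_add _
      map_smul' := fun a x => by
        conv_lhs => rw [← h2 x, ← map_smul, h1]
        rfl
      cont := u⁻¹.1.continuous }
  exact ⟨⟨S, R, ContinuousLinearMap.ext h2, ContinuousLinearMap.ext h1⟩, rfl⟩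

theorem isUnit_iff_bijective_of_complete [CompleteSpace V] {S : V →L[ℍᵐᵒᵖ] V} :
    IsUnit S ↔ Function.Bijective S :=
  ⟨bijective_of_isUnit, fun h => isUnit_of_isUnit_realOperator
    (ContinuousLinearMap.isUnit_iff_bijective.2 h)⟩

theorem realOperator_inverse {S : V →L[ℍᵐᵒᵖ] V} (h : IsUnit S) :
    realOperator (Ring.inverse S) = Ring.inverse (realOperator S) := by
  obtain ⟨u, rfl⟩ := h
  rw [Ring.inverse_unit]
  exact (Ring.inverse_unit (Units.map realOperator u)).symm

theorem continuous_realOperator_pseudoResolventPoly (T : V →L[ℍᵐᵒᵖ] V) :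
    Continuous fun p => realOperator (pseudoResolventPoly T p) := by
  have h : (fun p : ℍ => realOperator (pseudoResolventPoly T p)) = fun p =>
      realOperator T ^ 2 - (2 * p.re) • realOperator T + (‖p‖ ^ 2) • (1 : V →L[ℝ] V) := by
    ext p x
    simp [realOperator_apply, pseudoResolventPoly_apply, sq (realOperator T)]
  rw [h]
  have := Quaternion.continuous_re
  fun_prop

theorem isClosed_sSpectrum [CompleteSpace V] (T : V →L[ℍᵐᵒᵖ] V) : IsClosed (sSpectrum T) := by
  have h : (sSpectrum T)ᶜ =
      (fun p => realOperator (pseudoResolventPoly T p)) ⁻¹' {S | IsUnit S} := by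
    ext p
    simp only [sSpectrum, Set.mem_compl_iff, Set.mem_ofPred_eq, not_not, Set.mem_preimage]
    exact ⟨fun h => h.map realOperator, isUnit_of_isUnit_realOperator⟩
  rw [← isOpen_compl_iff, h]
  exact Units.isOpen.preimage (continuous_realOperator_pseudoResolventPoly T)

theorem continuous_realOperator_inverse_pseudoResolventPoly [CompleteSpace V] {X : Type*}
    [TopologicalSpace X] {f : X → ℍ} (hf : Continuous f) {T : V →L[ℍᵐᵒᵖ] V}
    (h : ∀ t, f t ∉ sSpectrum T) :
    Continuous fun t => realOperator (Ring.inverse (pseudoResolventPoly T (f t))) := by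
  have hu : ∀ t, IsUnit (pseudoResolventPoly T (f t)) := fun t => not_not.1 (h t)
  have h1 : (fun t => realOperator (Ring.inverse (pseudoResolventPoly T (f t)))) =
      fun t => Ring.inverse (realOperator (pseudoResolventPoly T (f t))) :=
    funext fun t => realOperator_inverse (hu t)
  rw [h1, continuous_iff_continuousAt]
  intro t
  obtain ⟨u, hu'⟩ := (hu t).map realOperator
  have h2 := NormedRing.inverse_continuousAt u
  rw [hu'] at h2
  exact ContinuousAt.comp (f := fun t => realOperator (pseudoResolventPoly T (f t))) h2
    ((continuous_realOperator_pseudoResolventPoly T).comp hf).continuousAt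

theorem coe_pseudoResolventPoly_restrict {T : V →L[ℍᵐᵒᵖ] V} {W : Submodule ℍᵐᵒᵖ V}
    (hW : Set.MapsTo T W W) (p : ℍ) (x : W) :
    (pseudoResolventPoly (T.restrict hW) p x : V) = pseudoResolventPoly T p x := by
  rw [pseudoResolventPoly_apply, pseudoResolventPoly_apply]
  rfl

/-- The operator is block diagonal, hence bijective; the open mapping theorem on `V` then bounds the
inverse, so the summands need not be closed. -/
theorem notMem_sSpectrum_of_restrict [CompleteSpace V] {T : V →L[ℍᵐᵒᵖ] V}
    {V₁ V₂ : Submodule ℍᵐᵒᵖ V} {h₁ : Set.MapsTo T V₁ V₁} {h₂ : Set.MapsTo T V₂ V₂}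
    (hc : IsCompl V₁ V₂) {p : ℍ} (hp₁ : p ∉ sSpectrum (T.restrict h₁))
    (hp₂ : p ∉ sSpectrum (T.restrict h₂)) : p ∉ sSpectrum T := by
  have hb₁ := bijective_of_isUnit (not_not.1 hp₁)
  have hb₂ := bijective_of_isUnit (not_not.1 hp₂)
  refine not_not.2 (isUnit_iff_bijective_of_complete.2 ⟨?_, fun y => ?_⟩)
  · refine (injective_iff_map_eq_zero _).2 fun x hx => ?_
    obtain ⟨y, hy, z, hz, rfl⟩ := Submodule.mem_sup.1
      (hc.sup_eq_top ▸ Submodule.mem_top : x ∈ V₁ ⊔ V₂)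
    rw [map_add, ← coe_pseudoResolventPoly_restrict h₁ p ⟨y, hy⟩,
      ← coe_pseudoResolventPoly_restrict h₂ p ⟨z, hz⟩] at hx
    have h3 := eq_neg_of_add_eq_zero_left hx
    have h4 : (pseudoResolventPoly (T.restrict h₁) p ⟨y, hy⟩ : V) = 0 :=
      Submodule.disjoint_def.1 hc.disjoint _ (Subtype.prop _)
        (h3 ▸ V₂.neg_mem (Subtype.prop _))
    rw [h4, zero_add] at hx
    have h5 : y = 0 := congrArg Subtype.val
      ((injective_iff_map_eq_zero _).1 hb₁.1 ⟨y, hy⟩ (Subtype.ext h4))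
    have h6 : z = 0 := congrArg Subtype.val
      ((injective_iff_map_eq_zero _).1 hb₂.1 ⟨z, hz⟩ (Subtype.ext hx))
    rw [h5, h6, add_zero]
  · obtain ⟨u, hu, v, hv, rfl⟩ := Submodule.mem_sup.1
      (hc.sup_eq_top ▸ Submodule.mem_top : y ∈ V₁ ⊔ V₂)
    obtain ⟨a, ha⟩ := hb₁.2 ⟨u, hu⟩
    obtain ⟨c, hc'⟩ := hb₂.2 ⟨v, hv⟩
    refine ⟨a + c, ?_⟩
    rw [map_add, ← coe_pseudoResolventPoly_restrict h₁, ← coe_pseudoResolventPoly_restrict h₂, ha,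
      hc']

theorem bijective_restrict_of_notMem_sSpectrum {T : V →L[ℍᵐᵒᵖ] V}
    {V₁ V₂ : Submodule ℍᵐᵒᵖ V} (h₁ : Set.MapsTo T V₁ V₁) (h₂ : Set.MapsTo T V₂ V₂)
    (hc : IsCompl V₁ V₂) {p : ℍ} (hp : p ∉ sSpectrum T) :
    Function.Bijective (pseudoResolventPoly (T.restrict h₂) p) := by
  have hb := bijective_of_isUnit (not_not.1 hp)
  refine ⟨fun x y h => Subtype.ext (hb.1 ?_), fun y => ?_⟩
  · rw [← coe_pseudoResolventPoly_restrict h₂, h, coe_pseudoResolventPoly_restrict]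
  · obtain ⟨x, hx⟩ := hb.2 y
    obtain ⟨u, hu, v, hv, rfl⟩ := Submodule.mem_sup.1
      (hc.sup_eq_top ▸ Submodule.mem_top : x ∈ V₁ ⊔ V₂)
    refine ⟨⟨v, hv⟩, Subtype.ext ?_⟩
    rw [map_add, ← coe_pseudoResolventPoly_restrict h₁ p ⟨u, hu⟩,
      ← coe_pseudoResolventPoly_restrict h₂ p ⟨v, hv⟩] at hx
    have h3 := eq_sub_of_add_eq hx
    have h4 : (pseudoResolventPoly (T.restrict h₁) p ⟨u, hu⟩ : V) = 0 :=
      Submodule.disjoint_def.1 hc.disjoint _ (Subtype.prop _)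
        (h3 ▸ V₂.sub_mem (Subtype.prop _) (Subtype.prop _))
    rw [← hx, h4, zero_add]

/-- A bounded inverse on `W` of `Q_q(T)` dominates the decay of `Q_q(T)ⁿ` on `W`. -/
theorem exists_norm_le_pow_mul_norm {T : V →L[ℍᵐᵒᵖ] V} {W : Submodule ℍᵐᵒᵖ V}
    {hW : Set.MapsTo T W W} {q : ℍ} (hq : q ∉ sSpectrum (T.restrict hW)) :
    ∃ C > 0, ∀ (n : ℕ), ∀ x ∈ W, ‖x‖ ≤ C ^ n * ‖(pseudoResolventPoly T q ^ n) x‖ := by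
  obtain ⟨u, hu⟩ := not_not.1 hq
  let R : W →L[ℝ] W := realOperator u⁻¹.1
  refine ⟨‖R‖ + 1, by positivity, fun n => ?_⟩
  induction n with
  | zero => intro x _; simp
  | succ n ih =>
    intro x hx
    have h1 : u⁻¹.1 (u.1 ⟨x, hx⟩) = ⟨x, hx⟩ := by
      rw [← mul_apply_eq_comp, Units.inv_mul]
      rfl
    have h2 : (u.1 ⟨x, hx⟩ : V) = pseudoResolventPoly T q x := by
      rw [hu, coe_pseudoResolventPoly_restrict]
    calc ‖x‖ = ‖R (u.1 ⟨x, hx⟩)‖ := by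
          change _ = ‖u⁻¹.1 (u.1 ⟨x, hx⟩)‖
          rw [h1]
          rfl
      _ ≤ ‖R‖ * ‖u.1 ⟨x, hx⟩‖ := R.le_opNorm _
      _ ≤ (‖R‖ + 1) * ‖(u.1 ⟨x, hx⟩ : V)‖ := by
          rw [Submodule.coe_norm]
          gcongr
          linarith
      _ ≤ (‖R‖ + 1) * ((‖R‖ + 1) ^ n * ‖(pseudoResolventPoly T q ^ n) (u.1 ⟨x, hx⟩ : V)‖) := by
          gcongr
          exact ih _ (Subtype.prop _)
      _ = _ := by
          rw [h2, ← mul_apply_eq_comp, ← pow_succ, ← mul_assoc, ← pow_succ']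

/-- Let a sequence `f k` in `V₂` tend to `u + v`. A power of `Q_q(T)` that kills `u` sends `f k - v`
to a null sequence, and the lower bound on `V₂` forces `f k → v`. -/
theorem isClosed_of_forall_exists_pow_eq_zero {T : V →L[ℍᵐᵒᵖ] V} {V₁ V₂ : Submodule ℍᵐᵒᵖ V}
    {h₂ : Set.MapsTo T V₂ V₂} (hc : IsCompl V₁ V₂) {q : ℍ} (hq : q ∉ sSpectrum (T.restrict h₂))
    (hnil : ∀ x ∈ V₁, ∃ n : ℕ, (pseudoResolventPoly T q ^ n) x = 0) :
    IsClosed (V₂ : Set V) := by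
  refine isClosed_of_closure_subset fun y hy => ?_
  obtain ⟨f, hf, hlim⟩ := mem_closure_iff_seq_limit.1 hy
  obtain ⟨u, hu, v, hv, rfl⟩ := Submodule.mem_sup.1
    (hc.sup_eq_top ▸ Submodule.mem_top : y ∈ V₁ ⊔ V₂)
  obtain ⟨n, hn⟩ := hnil u hu
  obtain ⟨C, hC, hb⟩ := exists_norm_le_pow_mul_norm hq
  have h1 : Tendsto (fun k => (pseudoResolventPoly T q ^ n) (f k - v)) atTop (𝓝 0) := by
    have h := ((pseudoResolventPoly T q ^ n).continuous.tendsto _).comp (hlim.sub_const v)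
    rw [add_sub_cancel_right, hn] at h
    exact h
  have h2 : Tendsto (fun k => f k - v) atTop (𝓝 0) := by
    refine squeeze_zero_norm (fun k => hb n _ (V₂.sub_mem (hf k) hv)) ?_
    simpa using h1.norm.const_mul (C ^ n)
  have h3 : u + v = v := by
    have h := h2.add_const v
    simp only [sub_add_cancel, zero_add] at h
    exact tendsto_nhds_unique hlim h
  rw [h3]
  exact hv

/-- If the `V₂`-component `v` is nonzero, then `‖v‖^(1/n) ≤ C ‖Q_q(T)ⁿ x‖^(1/n)` for large `n`, and
the left side tends to `1`. -/
theorem tendsto_norm_pow_rpow_zero_iff {T : V →L[ℍᵐᵒᵖ] V} {V₁ V₂ : Submodule ℍᵐᵒᵖ V}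
    {h₂ : Set.MapsTo T V₂ V₂} (hc : IsCompl V₁ V₂) {q : ℍ} (hq : q ∉ sSpectrum (T.restrict h₂))
    (hnil : ∀ x ∈ V₁, ∃ n : ℕ, (pseudoResolventPoly T q ^ n) x = 0) (x : V) :
    Tendsto (fun n : ℕ => ‖(pseudoResolventPoly T q ^ n) x‖ ^ (1 / (n : ℝ))) atTop (𝓝 0) ↔
      x ∈ V₁ := by
  have hzero : ∀ y ∈ V₁, ∀ᶠ n : ℕ in atTop, (pseudoResolventPoly T q ^ n) y = 0 := by
    intro y hy
    obtain ⟨N, hN⟩ := hnil y hy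
    filter_upwards [eventually_ge_atTop N] with n hn
    rw [← Nat.sub_add_cancel hn, pow_add, mul_apply_eq_comp, hN, map_zero]
  constructor
  · intro h
    obtain ⟨u, hu, v, hv, rfl⟩ := Submodule.mem_sup.1
      (hc.sup_eq_top ▸ Submodule.mem_top : x ∈ V₁ ⊔ V₂)
    by_cases hv0 : v = 0
    · rwa [hv0, add_zero]
    exfalso
    obtain ⟨C, hC, hb⟩ := exists_norm_le_pow_mul_norm hq
    have hone : Tendsto (fun n : ℕ => ‖v‖ ^ (1 / (n : ℝ))) atTop (𝓝 1) := by
      have h1 := (tendsto_const_nhds (x := ‖v‖)).rpow tendsto_one_div_atTop_nhds_zero_nat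
        (Or.inl (norm_ne_zero_iff.2 hv0))
      simpa using h1
    have hle : ∀ᶠ n : ℕ in atTop, ‖v‖ ^ (1 / (n : ℝ)) ≤
        C * ‖(pseudoResolventPoly T q ^ n) (u + v)‖ ^ (1 / (n : ℝ)) := by
      filter_upwards [hzero u hu, eventually_gt_atTop 0] with n hn hpos
      have hn0 : n ≠ 0 := hpos.ne'
      calc ‖v‖ ^ (1 / (n : ℝ))
          ≤ (C ^ n * ‖(pseudoResolventPoly T q ^ n) (u + v)‖) ^ (1 / (n : ℝ)) := by
            rw [map_add, hn, zero_add]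
            exact Real.rpow_le_rpow (norm_nonneg _) (hb n v hv) (by positivity)
        _ = _ := by
            rw [Real.mul_rpow (by positivity) (norm_nonneg _), one_div,
              Real.pow_rpow_inv_natCast hC.le hn0]
    have := le_of_tendsto_of_tendsto hone (h.const_mul C) hle
    linarith
  · intro hx
    refine tendsto_const_nhds.congr' ?_
    -- At `n = 0` the exponent `1 / 0` is `0` and `0 ^ 0 = 1`, so that index is excluded.
    filter_upwards [hzero x hx, eventually_gt_atTop 0] with n hn hpos
    rw [hn, norm_zero, Real.zero_rpow]
    positivity

/-- The `S`-spectrum of `T` on `V₂` is closed and misses `q`, so a small ball about `q` meets the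
`S`-spectrum of `T` only in that of the restriction to `V₁`, which is `[q]`. -/
theorem exists_isAdmissibleRadius [CompleteSpace V] {T : V →L[ℍᵐᵒᵖ] V}
    {V₁ V₂ : Submodule ℍᵐᵒᵖ V} {h₁ : Set.MapsTo T V₁ V₁} {h₂ : Set.MapsTo T V₂ V₂}
    (hc : IsCompl V₁ V₂) {q : ℍ} (hqT : q ∈ sSpectrum T)
    (hq : q ∉ sSpectrum (T.restrict h₂)) (hV₂ : IsClosed (V₂ : Set V))
    (hσ : sSpectrum (T.restrict h₁) = quaternionSphere q) : ∃ r, IsAdmissibleRadius T q r := by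
  have : CompleteSpace V₂ := hV₂.completeSpace_coe
  obtain ⟨ε, hε, hball⟩ := Metric.nhds_basis_closedBall.mem_iff.1
    ((isClosed_sSpectrum (T.restrict h₂)).isOpen_compl.mem_nhds hq)
  obtain ⟨r, hr, hrε, hrim⟩ : ∃ r > 0, r ≤ ε ∧ (q.im ≠ 0 → r < ‖q.im‖) := by
    by_cases h : q.im = 0
    · exact ⟨ε, hε, le_rfl, fun h' => absurd h h'⟩
    · have := norm_pos_iff.2 h
      exact ⟨min ε (‖q.im‖ / 2), lt_min hε (half_pos this), min_le_left _ _,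
        fun _ => (min_le_right _ _).trans_lt (half_lt_self this)⟩
  refine ⟨r, hr, Set.Subset.antisymm ?_ ?_, hrim⟩
  · rintro p ⟨hp, hpT⟩
    obtain ⟨p', hp', hpp⟩ := Set.mem_iUnion₂.1 hp
    have h1 : p' ∈ sSpectrum T := (mem_sSpectrum_congr hpp).1 hpT
    have h2 : p' ∉ sSpectrum (T.restrict h₂) :=
      hball (Metric.closedBall_subset_closedBall hrε hp')
    have h3 : p' ∈ sSpectrum (T.restrict h₁) := by
      by_contra h3
      exact notMem_sSpectrum_of_restrict hc h3 h2 h1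
    rw [hσ, mem_quaternionSphere_iff] at h3
    rw [mem_quaternionSphere_iff] at hpp ⊢
    exact ⟨hpp.1.trans h3.1, hpp.2.trans h3.2⟩
  · intro p hp
    exact ⟨Set.mem_iUnion₂.2 ⟨q, Metric.mem_closedBall_self hr.le, hp⟩,
      (mem_sSpectrum_congr hp).2 hqT⟩

end RightLinear

/-! ### The complex structure given by right multiplication -/

section ComplexStructure

/-- The circle integral uses the real structure derived from the complex one. Once `h` identifies it
with the given one, this is `dz = i (z - c) dθ`. -/
theorem circleIntegral_eq_I_smul {V : Type*} [NormedAddCommGroup V] [i : NormedSpace ℝ V] [NormedSpace ℂ V]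
    (h : ∀ (a : ℝ) (x : V), (a : ℂ) • x = a • x) (f : ℂ → V) (c : ℂ) (r : ℝ) :
    (∮ z in C(c, r), f z) = Complex.I • ∫ θ in (0 : ℝ)..(2 * Real.pi),
      circleMap 0 r θ • f (circleMap c r θ) := by
  obtain rfl : i = NormedSpace.complexToReal := by
    apply NormedSpace.ext
    ext a x
    exact (h a x).symm
  rw [← intervalIntegral.integral_smul]
  simp only [circleIntegral, deriv_circleMap, smul_smul, mul_comm]

variable {V : Type*} [NormedAddCommGroup V] [Module ℍᵐᵒᵖ V]

/-- The embedding of the complex numbers into the opposite quaternions. -/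
noncomputable def complexToOp : ℂ →+* ℍᵐᵒᵖ :=
  (Quaternion.ofComplex : ℂ →+* ℍ).toOpposite fun z w => (Commute.all z w).map _

theorem norm_coe_complex (z : ℂ) : ‖(z : ℍ)‖ = ‖z‖ := by
  have h : ‖(z : ℍ)‖ * ‖(z : ℍ)‖ = ‖z‖ * ‖z‖ := by
    rw [← Quaternion.normSq_eq_norm_mul_self, ← sq ‖z‖, ← Complex.normSq_eq_norm_sq,
      Quaternion.normSq_def', Complex.normSq_apply]
    simp
    ring
  exact (mul_self_inj (norm_nonneg _) (norm_nonneg _)).1 h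

theorem continuous_coe_complex : Continuous fun z : ℂ => (z : ℍ) :=
  LinearMap.continuous_of_finiteDimensional Quaternion.ofComplex.toLinearMap

/-- Right multiplication by complex numbers makes a right quaternionic Hilbert space a complex
normed space. -/
@[reducible] noncomputable def rightComplexSpace [RightQuaternionicInner V] : NormedSpace ℂ V :=
  { Module.compHom V complexToOp with
    norm_smul_le := fun z x => by
      change ‖op (z : ℍ) • x‖ ≤ _
      rw [RightQuaternionicInner.norm_op_smul, norm_coe_complex, mul_comm] }

theorem map_complex_smul [NormedSpace ℂ V]
    (hsm : ∀ (z : ℂ) (x : V), z • x = op (z : ℍ) • x)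
    (S : V →L[ℍᵐᵒᵖ] V) (z : ℂ) (x : V) : S (z • x) = z • S x := by
  rw [hsm, hsm, map_smul]

variable [NormedSpace ℝ V] [IsScalarTower ℝ ℍᵐᵒᵖ V]

theorem pseudoResolventPoly_conj (T : V →L[ℍᵐᵒᵖ] V) (z : ℂ) :
    pseudoResolventPoly T (conj z : ℂ) = pseudoResolventPoly T z :=
  pseudoResolventPoly_congr T (by simp) (by simp [norm_coe_complex])

variable [NormedSpace ℂ V]

theorem ofReal_smul_eq (hsm : ∀ (z : ℂ) (x : V), z • x = op (z : ℍ) • x) (a : ℝ) (x : V) :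
    (a : ℂ) • x = a • x := by
  rw [hsm, real_smul_eq_op_smul, Quaternion.coeComplex_coe]

theorem complex_smul_eq (hsm : ∀ (z : ℂ) (x : V), z • x = op (z : ℍ) • x) (z : ℂ) (x : V) :
    z • x = z.re • x + z.im • Complex.I • x := by
  conv_lhs => rw [← Complex.re_add_im z]
  rw [add_smul, mul_smul, ofReal_smul_eq hsm, ofReal_smul_eq hsm]

/-- A right linear operator as a complex linear operator. -/
noncomputable def complexOperator (hsm : ∀ (z : ℂ) (x : V), z • x = op (z : ℍ) • x)
    (S : V →L[ℍᵐᵒᵖ] V) : V →L[ℂ] V where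
  toFun := S
  map_add' := map_add S
  map_smul' := map_complex_smul hsm S
  cont := S.continuous

/-- A right linear subspace as a complex subspace. -/
def complexSubmodule (hsm : ∀ (z : ℂ) (x : V), z • x = op (z : ℍ) • x)
    (W : Submodule ℍᵐᵒᵖ V) : Submodule ℂ V where
  carrier := W
  zero_mem' := W.zero_mem
  add_mem' := W.add_mem
  smul_mem' z x hx := by
    rw [hsm]
    exact W.smul_mem _ hx

/-- Finite dimension passes from `ℍᵐᵒᵖ` down to `ℝ`, and a real spanning set also spans over `ℂ`. -/
theorem finiteDimensional_complexSubmodule (hsm : ∀ (z : ℂ) (x : V), z • x = op (z : ℍ) • x)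
    (W : Submodule ℍᵐᵒᵖ V) [Module.Finite ℍᵐᵒᵖ W] :
    FiniteDimensional ℂ (complexSubmodule hsm W) := by
  have h1 : Module.Finite ℝ ℍᵐᵒᵖ := Module.Finite.equiv (opLinearEquiv ℝ : ℍ ≃ₗ[ℝ] ℍᵐᵒᵖ)
  have h2 : Module.Finite ℝ W := Module.Finite.trans ℍᵐᵒᵖ W
  have h3 : Module.Finite ℝ (W.restrictScalars ℝ) := h2
  obtain ⟨t, ht⟩ := Module.Finite.iff_fg.1 h3
  refine Module.Finite.iff_fg.2 ⟨t, le_antisymm (Submodule.span_le.2 fun x hx => ?_) fun x hx => ?_⟩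
  · have h4 : x ∈ W.restrictScalars ℝ := ht ▸ Submodule.subset_span hx
    exact h4
  · have h4 : x ∈ Submodule.span ℝ (t : Set V) := by
      rw [ht]
      exact hx
    induction h4 using Submodule.span_induction with
    | mem x h => exact Submodule.subset_span h
    | zero => exact Submodule.zero_mem _
    | add x y hx' hy' ihx ihy =>
      refine Submodule.add_mem _ (ihx ?_) (ihy ?_)
      · exact (ht ▸ hx' : x ∈ W.restrictScalars ℝ)
      · exact (ht ▸ hy' : y ∈ W.restrictScalars ℝ)
    | smul a x hx' ihx =>
      rw [← ofReal_smul_eq hsm]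
      exact Submodule.smul_mem _ _ (ihx (ht ▸ hx' : x ∈ W.restrictScalars ℝ))

/-- This is `Q_z(T) = (z̄ - T)(z - T)` with scalars acting on the right: they commute with `T`, and
`z + z̄` and `z z̄` are real. -/
theorem pseudoResolventPoly_eq_factor (hsm : ∀ (z : ℂ) (x : V), z • x = op (z : ℍ) • x)
    (T : V →L[ℍᵐᵒᵖ] V) (z : ℂ) (x : V) :
    conj z • (z • x - T x) - T (z • x - T x) = pseudoResolventPoly T z x := by
  have h1 : (2 * z.re) • T x = z • T x + conj z • T x := by
    rw [← ofReal_smul_eq hsm, ← add_smul, Complex.add_conj]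
  have h2 : (‖z‖ ^ 2) • x = conj z • z • x := by
    rw [← ofReal_smul_eq hsm, smul_smul, ← Complex.normSq_eq_conj_mul_self,
      Complex.normSq_eq_norm_sq]
  rw [pseudoResolventPoly_apply, norm_coe_complex, Quaternion.re_coeComplex, h1, h2,
    map_sub, map_complex_smul hsm, smul_sub]
  abel

theorem pseudoResolventPoly_eq_factor' (hsm : ∀ (z : ℂ) (x : V), z • x = op (z : ℍ) • x)
    (T : V →L[ℍᵐᵒᵖ] V) (z : ℂ) (x : V) :
    z • (conj z • x - T x) - T (conj z • x - T x) = pseudoResolventPoly T z x := by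
  have h := pseudoResolventPoly_eq_factor hsm T (conj z) x
  rwa [Complex.conj_conj, pseudoResolventPoly_conj] at h

/-- One order of the factors of `Q_z(T)` gives injectivity of `z - T`, the other surjectivity. -/
theorem mem_resolventSet_complexOperator [CompleteSpace V]
    (hsm : ∀ (z : ℂ) (x : V), z • x = op (z : ℍ) • x) {T : V →L[ℍᵐᵒᵖ] V} {z : ℂ}
    (hz : (z : ℍ) ∉ sSpectrum T) : z ∈ resolventSet ℂ (complexOperator hsm T) := by
  have hb := bijective_of_isUnit (not_not.1 hz)
  have happ : ∀ y, (algebraMap ℂ (V →L[ℂ] V) z - complexOperator hsm T) y = z • y - T y := by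
    intro y
    rw [Algebra.algebraMap_eq_smul_one]
    rfl
  refine ContinuousLinearMap.isUnit_iff_bijective.2 ⟨?_, fun y => ?_⟩
  · refine (injective_iff_map_eq_zero _).2 fun x hx => ?_
    refine (injective_iff_map_eq_zero _).1 hb.1 x ?_
    rw [happ] at hx
    rw [← pseudoResolventPoly_eq_factor hsm, hx, smul_zero, map_zero, sub_zero]
  · obtain ⟨x, rfl⟩ := hb.2 y
    exact ⟨conj z • x - T x, by rw [happ, pseudoResolventPoly_eq_factor' hsm]⟩

theorem resolvent_complexOperator_apply [CompleteSpace V]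
    (hsm : ∀ (z : ℂ) (x : V), z • x = op (z : ℍ) • x) {T : V →L[ℍᵐᵒᵖ] V} {z : ℂ}
    (hz : (z : ℍ) ∉ sSpectrum T) (x : V) :
    resolvent (complexOperator hsm T) z x =
      Ring.inverse (pseudoResolventPoly T z) (conj z • x - T x) := by
  refine resolvent_apply_of_sub_eq (mem_resolventSet_complexOperator hsm hz) ?_
  have hb := bijective_of_isUnit (not_not.1 hz)
  -- Writing `x = Q_z(T) y` means that only `Q_z(T)`, and not its inverse, has to be commuted with
  -- `T`.
  obtain ⟨y, hy⟩ := hb.2 (x)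
  have hinv : ∀ v, Ring.inverse (pseudoResolventPoly T z) (pseudoResolventPoly T z v) = v := by
    intro v
    rw [← mul_apply_eq_comp, Ring.inverse_mul_cancel _ (not_not.1 hz)]
    rfl
  change z • _ - T _ = x
  have h1 : conj z • x - T x = pseudoResolventPoly T z (conj z • y - T y) := by
    rw [← hy, ← map_complex_smul hsm, map_sub]
    congr 1
    simp only [pseudoResolventPoly_apply, map_sub, map_add, map_real_smul T T.continuous]
  rw [h1, hinv, pseudoResolventPoly_eq_factor' hsm, hy]

/-- The factors `T - c̄` and `T - c` commute, so `Q_c(T)^N = (T - c̄)^N (T - c)^N`. -/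
theorem exists_pseudoResolventPoly_pow_eq_zero
    (hsm : ∀ (z : ℂ) (x : V), z • x = op (z : ℍ) • x) {T : V →L[ℍᵐᵒᵖ] V} {c : ℂ} {N : ℕ} {x : V}
    (hx : ((complexOperator hsm T - algebraMap ℂ (V →L[ℂ] V) c) ^ N) x = 0) :
    (pseudoResolventPoly T c ^ N) x = 0 := by
  set A := complexOperator hsm T
  have happ : ∀ (z : ℂ) y, (A - algebraMap ℂ (V →L[ℂ] V) z) y = T y - z • y := by
    intro z y
    rw [Algebra.algebraMap_eq_smul_one]
    rfl
  have hpow : ∀ (n : ℕ) y, (pseudoResolventPoly T c ^ n) y =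
      (((A - algebraMap ℂ (V →L[ℂ] V) (conj c)) * (A - algebraMap ℂ (V →L[ℂ] V) c)) ^ n) y := by
    intro n
    induction n with
    | zero => intro y; rfl
    | succ n ih =>
      intro y
      rw [pow_succ, pow_succ, mul_apply_eq_comp, mul_apply_eq_comp, ih, mul_apply_eq_comp, happ,
        happ, ← pseudoResolventPoly_eq_factor hsm]
      congr 1
      simp only [map_sub, smul_sub]
      abel
  have hcomm : Commute (A - algebraMap ℂ (V →L[ℂ] V) (conj c))
      (A - algebraMap ℂ (V →L[ℂ] V) c) :=
    ((Commute.refl A).sub_left (Algebra.commutes _ _)).sub_right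
      (Algebra.commutes _ _).symm
  rw [hpow, hcomm.mul_pow, mul_apply_eq_comp, hx, map_zero]

end ComplexStructure

/-! ### The Riesz projection -/

section RieszIntegral

variable {V : Type*} [NormedAddCommGroup V] [NormedSpace ℝ V] [Module ℍᵐᵒᵖ V]
  [IsScalarTower ℝ ℍᵐᵒᵖ V]

/-- The real part `Q_z(T)⁻¹ (Re(z̄ w) - Re(w) T)` of the resolvent kernel `Q_z(T)⁻¹ (z̄ - T) w`. -/
noncomputable def resolventRe (T : V →L[ℍᵐᵒᵖ] V) (z w : ℂ) : V →L[ℝ] V :=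
  realOperator (Ring.inverse (pseudoResolventPoly T z)) *
    ((conj z * w).re • (1 : V →L[ℝ] V) - w.re • realOperator T)

/-- The imaginary part `Q_z(T)⁻¹ (Im(z̄ w) - Im(w) T)` of the resolvent kernel
`Q_z(T)⁻¹ (z̄ - T) w`. -/
noncomputable def resolventIm (T : V →L[ℍᵐᵒᵖ] V) (z w : ℂ) : V →L[ℝ] V :=
  realOperator (Ring.inverse (pseudoResolventPoly T z)) *
    ((conj z * w).im • (1 : V →L[ℝ] V) - w.im • realOperator T)

theorem resolventIm_conj (T : V →L[ℍᵐᵒᵖ] V) (z w : ℂ) :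
    resolventIm T (conj z) (conj w) = -resolventIm T z w := by
  have h : (conj (conj z) * conj w).im = -(conj z * w).im := by
    rw [← map_mul, Complex.conj_im]
  rw [resolventIm, resolventIm, pseudoResolventPoly_conj, h, Complex.conj_im, ← mul_neg]
  congr 1
  module

theorem continuous_resolventRe [CompleteSpace V] {T : V →L[ℍᵐᵒᵖ] V} {z w : ℝ → ℂ}
    (hz : Continuous z) (hw : Continuous w) (h : ∀ θ, (z θ : ℍ) ∉ sSpectrum T) :
    Continuous fun θ => resolventRe T (z θ) (w θ) := by
  have h1 := continuous_realOperator_inverse_pseudoResolventPoly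
    (continuous_coe_complex.comp hz) h
  unfold resolventRe
  fun_prop

theorem continuous_resolventIm [CompleteSpace V] {T : V →L[ℍᵐᵒᵖ] V} {z w : ℝ → ℂ}
    (hz : Continuous z) (hw : Continuous w) (h : ∀ θ, (z θ : ℍ) ∉ sSpectrum T) :
    Continuous fun θ => resolventIm T (z θ) (w θ) := by
  have h1 := continuous_realOperator_inverse_pseudoResolventPoly
    (continuous_coe_complex.comp hz) h
  unfold resolventIm
  fun_prop

theorem circleMap_conj_sub (c : ℂ) (r θ : ℝ) :
    circleMap (conj c) r (2 * Real.pi - θ) = conj (circleMap c r θ) := by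
  simp only [circleMap, map_add, map_mul, Complex.conj_ofReal, ← Complex.exp_conj, Complex.conj_I]
  congr 2
  rw [Complex.exp_eq_exp_iff_exists_int]
  exact ⟨1, by push_cast; ring⟩

/-- The substitution `θ ↦ 2π - θ` conjugates both the point and its velocity factor, under which
`resolventIm` is odd. -/
theorem integral_resolventIm_conj (T : V →L[ℍᵐᵒᵖ] V) (c : ℂ) (r : ℝ) (y : V) :
    (∫ θ in (0 : ℝ)..(2 * Real.pi),
        resolventIm T (circleMap (conj c) r θ) (circleMap 0 r θ) y) =
      -∫ θ in (0 : ℝ)..(2 * Real.pi), resolventIm T (circleMap c r θ) (circleMap 0 r θ) y := by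
  have h := intervalIntegral.integral_comp_sub_left (a := 0) (b := 2 * Real.pi)
    (fun θ => resolventIm T (circleMap (conj c) r θ) (circleMap 0 r θ) y) (2 * Real.pi)
  rw [sub_self, sub_zero] at h
  rw [← h, ← intervalIntegral.integral_neg]
  congr 1
  ext θ
  have h0 := circleMap_conj_sub 0 r θ
  rw [map_zero] at h0
  rw [circleMap_conj_sub, h0, resolventIm_conj]
  rfl

theorem sum_integral_resolventIm (T : V →L[ℍᵐᵒᵖ] V) (a d r : ℝ) (y : V) :
    ∑ c ∈ ({⟨a, d⟩, ⟨a, -d⟩} : Finset ℂ), (∫ θ in (0 : ℝ)..(2 * Real.pi),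
      resolventIm T (circleMap c r θ) (circleMap 0 r θ) y) = 0 := by
  have hconj : (⟨a, -d⟩ : ℂ) = conj ⟨a, d⟩ := rfl
  have h := integral_resolventIm_conj T ⟨a, d⟩ r y
  rw [hconj]
  -- For `d = 0` the two centres coincide, and the single integral equals its own negative.
  by_cases hd : (⟨a, d⟩ : ℂ) = conj ⟨a, d⟩
  · rw [← hd] at h ⊢
    rw [Finset.pair_eq_singleton, Finset.sum_singleton]
    have h2 := add_eq_zero_iff_eq_neg.2 h
    rw [← two_smul ℝ] at h2
    exact (smul_eq_zero_iff_right two_ne_zero).1 h2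
  · rw [Finset.sum_pair hd, h, add_neg_cancel]

/-- The vector `y` is arbitrary: `y = J x` (left multiplication) yields the Riesz projection and `y
= x i` the complex resolvent integral. -/
theorem sum_integral_resolventRe_add [CompleteSpace V] {T : V →L[ℍᵐᵒᵖ] V} {a d r : ℝ}
    (hr : 0 ≤ r) (h : ∀ c ∈ ({⟨a, d⟩, ⟨a, -d⟩} : Finset ℂ), ∀ z ∈ Metric.sphere c r,
      (z : ℍ) ∉ sSpectrum T) (x y : V) :
    ∑ c ∈ ({⟨a, d⟩, ⟨a, -d⟩} : Finset ℂ), (∫ θ in (0 : ℝ)..(2 * Real.pi),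
      (resolventRe T (circleMap c r θ) (circleMap 0 r θ) x +
        resolventIm T (circleMap c r θ) (circleMap 0 r θ) y)) =
    ∑ c ∈ ({⟨a, d⟩, ⟨a, -d⟩} : Finset ℂ), (∫ θ in (0 : ℝ)..(2 * Real.pi),
      resolventRe T (circleMap c r θ) (circleMap 0 r θ) x) := by
  rw [← add_zero (∑ c ∈ _, ∫ θ in (0 : ℝ)..(2 * Real.pi),
      resolventRe T (circleMap c r θ) (circleMap 0 r θ) x), ← sum_integral_resolventIm T a d r y,
    ← Finset.sum_add_distrib]
  refine Finset.sum_congr rfl fun c hc => ?_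
  have hs : ∀ θ, ((circleMap c r θ : ℂ) : ℍ) ∉ sSpectrum T :=
    fun θ => h c hc _ (circleMap_mem_sphere c hr θ)
  refine intervalIntegral.integral_add (Continuous.intervalIntegrable ?_ _ _)
    (Continuous.intervalIntegrable ?_ _ _)
  · exact (continuous_resolventRe (continuous_circleMap c r) (continuous_circleMap 0 r) hs).clm_apply
      continuous_const
  · exact (continuous_resolventIm (continuous_circleMap c r) (continuous_circleMap 0 r) hs).clm_apply
      continuous_const

theorem smul_resolvent_apply [CompleteSpace V] [NormedSpace ℂ V]
    (hsm : ∀ (z : ℂ) (x : V), z • x = op (z : ℍ) • x) {T : V →L[ℍᵐᵒᵖ] V} {z : ℂ}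
    (hz : (z : ℍ) ∉ sSpectrum T) (w : ℂ) (x : V) :
    w • resolvent (complexOperator hsm T) z x =
      resolventRe T z w x + resolventIm T z w (Complex.I • x) := by
  rw [resolvent_complexOperator_apply hsm hz, ← map_complex_smul hsm, smul_sub, smul_smul,
    mul_comm w, complex_smul_eq hsm (conj z * w), complex_smul_eq hsm w, resolventRe, resolventIm,
    mul_apply_eq_comp, mul_apply_eq_comp, realOperator_apply, realOperator_apply, ← map_add]
  congr 1
  simp only [sub_apply, smul_apply, one_apply_eq_self, realOperator_apply,
    map_complex_smul hsm]
  abel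

variable [RightQuaternionicInner V] [CompleteSpace V] {ι : Type*}

theorem leftSResolvent_mul_leftMul (b : QuaternionicHilbertBasis ι V) (T : V →L[ℍᵐᵒᵖ] V) {I : ℍ}
    (hI : I ∈ imaginaryUnits) (c : ℂ) (r θ : ℝ) :
    (leftSResolvent b T (toSlice I (circleMap c r θ)) *
      b.leftMul (-(toSlice I (deriv (circleMap c r) θ) * I))).restrictScalars ℝ =
    resolventRe T (circleMap c r θ) (circleMap 0 r θ) +
      resolventIm T (circleMap c r θ) (circleMap 0 r θ) * realOperator (b.leftMul I) := by
  generalize hz : circleMap c r θ = z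
  have hI' : I = toSlice I Complex.I := by simp [toSlice]
  -- On the circle `dp = w I dθ` with `w = p - c` in the slice, so `dp_I = -dp I = w dθ`.
  have h1 : -(toSlice I (deriv (circleMap c r) θ) * I) = toSlice I (circleMap 0 r θ) := by
    have h2 : toSlice I (deriv (circleMap c r) θ) * I =
        toSlice I (deriv (circleMap c r) θ * Complex.I) := by
      rw [toSlice_mul hI, ← hI']
    rw [h2, deriv_circleMap, mul_assoc, Complex.I_mul_I]
    simp [toSlice, add_comm]
  rw [h1]
  generalize circleMap 0 r θ = w
  have hQ : pseudoResolventPoly T (toSlice I z) = pseudoResolventPoly T z :=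
    pseudoResolventPoly_congr T (re_toSlice hI z)
      ((norm_toSlice hI z).trans (norm_coe_complex z).symm)
  have h3 : leftSResolvent b T (toSlice I z) * b.leftMul (toSlice I w) =
      Ring.inverse (pseudoResolventPoly T z) *
        (b.leftMul (toSlice I (conj z * w)) - T * b.leftMul (toSlice I w)) := by
    rw [leftSResolvent, hQ, star_toSlice hI, toSlice_mul hI, b.leftMul_mul]
    ext x
    simp only [mul_apply_eq_comp, sub_apply, neg_apply]
    rw [← map_neg, neg_sub]
  rw [h3, b.leftMul_toSlice, b.leftMul_toSlice]
  ext x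
  simp only [resolventRe, resolventIm, add_apply, mul_apply_eq_comp, realOperator_apply,
    ContinuousLinearMap.coe_restrictScalars', ← map_add]
  congr 1
  simp only [sub_apply, smul_apply, add_apply, one_apply_eq_self, realOperator_apply,
    mul_apply_eq_comp, map_add, map_real_smul T T.continuous]
  abel

/-- The right side involves neither `I` nor the Hilbert basis. -/
theorem rieszProjection_apply (b : QuaternionicHilbertBasis ι V) {T : V →L[ℍᵐᵒᵖ] V} {q I : ℍ}
    (hI : I ∈ imaginaryUnits) {r : ℝ} (hr : 0 ≤ r)
    (h : ∀ c ∈ ({⟨q.re, ‖q.im‖⟩, ⟨q.re, -‖q.im‖⟩} : Finset ℂ), ∀ z ∈ Metric.sphere c r,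
      (z : ℍ) ∉ sSpectrum T) (x : V) :
    rieszProjection b T q I r x = (1 / (2 * Real.pi)) •
      ∑ c ∈ ({⟨q.re, ‖q.im‖⟩, ⟨q.re, -‖q.im‖⟩} : Finset ℂ), (∫ θ in (0 : ℝ)..(2 * Real.pi),
        resolventRe T (circleMap c r θ) (circleMap 0 r θ) x) := by
  rw [← sum_integral_resolventRe_add hr h x (b.leftMul I x), rieszProjection, smul_apply,
    sum_apply]
  congr 1
  refine Finset.sum_congr rfl fun c hc => ?_
  have hs : ∀ θ, ((circleMap c r θ : ℂ) : ℍ) ∉ sSpectrum T :=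
    fun θ => h c hc _ (circleMap_mem_sphere c hr θ)
  simp only [circleSResolventIntegral, leftSResolvent_mul_leftMul b T hI]
  rw [ContinuousLinearMap.intervalIntegral_apply]
  · rfl
  · refine Continuous.intervalIntegrable ?_ _ _
    exact (continuous_resolventRe (continuous_circleMap c r) (continuous_circleMap 0 r) hs).add
      ((continuous_resolventIm (continuous_circleMap c r) (continuous_circleMap 0 r) hs).mul
        continuous_const)

theorem I_smul_rieszProjection_apply [NormedSpace ℂ V]
    (hsm : ∀ (z : ℂ) (x : V), z • x = op (z : ℍ) • x) (b : QuaternionicHilbertBasis ι V)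
    {T : V →L[ℍᵐᵒᵖ] V} {q I : ℍ} (hI : I ∈ imaginaryUnits) {r : ℝ} (hr : 0 ≤ r)
    (h : ∀ c ∈ ({⟨q.re, ‖q.im‖⟩, ⟨q.re, -‖q.im‖⟩} : Finset ℂ), ∀ z ∈ Metric.sphere c r,
      (z : ℍ) ∉ sSpectrum T) (x : V) :
    (2 * Real.pi * Complex.I : ℂ) • rieszProjection b T q I r x =
      ∑ c ∈ ({⟨q.re, ‖q.im‖⟩, ⟨q.re, -‖q.im‖⟩} : Finset ℂ),
        (∮ z in C(c, r), resolvent (complexOperator hsm T) z x) := by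
  rw [rieszProjection_apply b hI hr h, ← sum_integral_resolventRe_add hr h x (Complex.I • x),
    ← ofReal_smul_eq hsm, smul_smul]
  have hc : (2 * Real.pi * Complex.I : ℂ) * ((1 / (2 * Real.pi) : ℝ) : ℂ) = Complex.I := by
    have : (Real.pi : ℂ) ≠ 0 := by exact_mod_cast Real.pi_ne_zero
    push_cast
    field_simp
  rw [hc, Finset.smul_sum]
  refine Finset.sum_congr rfl fun c hc => ?_
  rw [circleIntegral_eq_I_smul (ofReal_smul_eq hsm)]
  congr 2
  ext θ
  exact (smul_resolvent_apply hsm (h c hc _ (circleMap_mem_sphere c hr θ)) _ x).symm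

end RieszIntegral

/-! ### Admissible radii and the action of the Riesz projection on the two summands. -/

section Admissible

theorem coe_complex_mem_quaternionSphere_iff {z : ℂ} {q : ℍ} :
    (z : ℍ) ∈ quaternionSphere q ↔ z ∈ ({⟨q.re, ‖q.im‖⟩, ⟨q.re, -‖q.im‖⟩} : Finset ℂ) := by
  have h1 : (z.im) ^ 2 = ‖(z : ℍ).im‖ ^ 2 := by
    have h := norm_sq_eq_re_add_im (z : ℍ)
    rw [norm_coe_complex, ← Complex.normSq_eq_norm_sq, Complex.normSq_apply,
      Quaternion.re_coeComplex] at h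
    linarith
  have h2 : ‖(z : ℍ).im‖ = ‖q.im‖ ↔ z.im = ‖q.im‖ ∨ z.im = -‖q.im‖ := by
    rw [← sq_eq_sq_iff_eq_or_eq_neg, h1, pow_left_inj₀ (norm_nonneg _) (norm_nonneg _) two_ne_zero]
  rw [mem_quaternionSphere_iff, h2, Quaternion.re_coeComplex, Finset.mem_insert,
    Finset.mem_singleton, Complex.ext_iff, Complex.ext_iff]
  tauto

theorem coe_complex_mem_axialHull {z c : ℂ} {q : ℍ} {r : ℝ}
    (hc : c ∈ ({⟨q.re, ‖q.im‖⟩, ⟨q.re, -‖q.im‖⟩} : Finset ℂ)) (hz : z ∈ Metric.closedBall c r) :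
    (z : ℍ) ∈ axialHull (Metric.closedBall q r) := by
  obtain ⟨J, hJ, hq⟩ := mem_quaternionSphere_self q
  -- The sphere of `z` meets the slice of `q` in the copies of `z` and `z̄`; one of these lies in
  -- the ball about `q`.
  have key : ∀ w : ℂ, ‖w‖ = ‖z‖ → w.re = z.re → w ∈ Metric.closedBall (⟨q.re, ‖q.im‖⟩ : ℂ) r →
      (z : ℍ) ∈ axialHull (Metric.closedBall q r) := by
    intro w hw hre hwb
    refine Set.mem_iUnion₂.2 ⟨toSlice J w, ?_, mem_quaternionSphere_iff_norm.2 ⟨?_, ?_⟩⟩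
    · have h1 : toSlice J w - q = toSlice J (w - ⟨q.re, ‖q.im‖⟩) := by
        conv_lhs => rw [hq]
        simp only [toSlice, Complex.sub_re, Complex.sub_im, Quaternion.coe_sub, mul_sub]
        abel
      rw [mem_closedBall_iff_norm, h1, norm_toSlice hJ]
      exact mem_closedBall_iff_norm.1 hwb
    · rw [re_toSlice hJ, Quaternion.re_coeComplex, hre]
    · rw [norm_toSlice hJ, norm_coe_complex, hw]
  rw [Finset.mem_insert, Finset.mem_singleton] at hc
  obtain rfl | rfl := hc
  · exact key z rfl rfl hz
  · refine key (conj z) (by simp) (by simp) ?_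
    have h1 : (⟨q.re, ‖q.im‖⟩ : ℂ) = conj ⟨q.re, -‖q.im‖⟩ := by simp [Complex.ext_iff]
    rw [mem_closedBall_iff_norm, h1, ← map_sub, Complex.norm_conj]
    exact mem_closedBall_iff_norm.1 hz

theorem notMem_closedBall_of_ne {q : ℍ} {r : ℝ} (hr : q.im ≠ 0 → r < ‖q.im‖) {c d : ℂ}
    (hc : c ∈ ({⟨q.re, ‖q.im‖⟩, ⟨q.re, -‖q.im‖⟩} : Finset ℂ))
    (hd : d ∈ ({⟨q.re, ‖q.im‖⟩, ⟨q.re, -‖q.im‖⟩} : Finset ℂ)) (hdc : d ≠ c) :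
    d ∉ Metric.closedBall c r := by
  have hne : q.im ≠ 0 := by
    intro h
    simp only [h, norm_zero, neg_zero, Finset.pair_eq_singleton, Finset.mem_singleton] at hc hd
    exact hdc (hd.trans hc.symm)
  have hpos := norm_pos_iff.2 hne
  have h1 : |(d - c).im| = 2 * ‖q.im‖ := by
    rw [Finset.mem_insert, Finset.mem_singleton] at hc hd
    obtain rfl | rfl := hc <;> obtain rfl | rfl := hd
    · exact absurd rfl hdc
    · rw [Complex.sub_im, abs_of_neg] <;> dsimp only <;> linarith
    · rw [Complex.sub_im, abs_of_pos] <;> dsimp only <;> linarith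
    · exact absurd rfl hdc
  intro h
  have h2 := (Complex.abs_im_le_norm (d - c)).trans (mem_closedBall_iff_norm.1 h)
  have := hr hne
  linarith

variable {V : Type*} [NormedAddCommGroup V] [NormedSpace ℝ V] [Module ℍᵐᵒᵖ V]
  [IsScalarTower ℝ ℍᵐᵒᵖ V] {T : V →L[ℍᵐᵒᵖ] V} {q : ℍ} {r : ℝ}

theorem IsAdmissibleRadius.notMem_sSpectrum (hr : IsAdmissibleRadius T q r) {z c : ℂ}
    (hc : c ∈ ({⟨q.re, ‖q.im‖⟩, ⟨q.re, -‖q.im‖⟩} : Finset ℂ)) (hz : z ∈ Metric.closedBall c r)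
    (hzq : (z : ℍ) ∉ quaternionSphere q) : (z : ℍ) ∉ sSpectrum T := fun h =>
  hzq (hr.2.1 ▸ ⟨coe_complex_mem_axialHull hc hz, h⟩)

theorem IsAdmissibleRadius.notMem_sSpectrum_of_mem_sphere (hr : IsAdmissibleRadius T q r) {z c : ℂ}
    (hc : c ∈ ({⟨q.re, ‖q.im‖⟩, ⟨q.re, -‖q.im‖⟩} : Finset ℂ)) (hz : z ∈ Metric.sphere c r) :
    (z : ℍ) ∉ sSpectrum T := by
  refine hr.notMem_sSpectrum hc (Metric.sphere_subset_closedBall hz) fun h => ?_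
  refine notMem_closedBall_of_ne hr.2.2 hc (coe_complex_mem_quaternionSphere_iff.1 h) ?_
    (Metric.sphere_subset_closedBall hz)
  rintro rfl
  exact hr.1.ne (by simpa using hz)

variable {V₁ V₂ : Submodule ℍᵐᵒᵖ V} {h₁ : Set.MapsTo T V₁ V₁} {h₂ : Set.MapsTo T V₂ V₂}

/-- Points of the disc on `[q]` are covered by `hq`; the others are outside the `S`-spectrum of `T`.
-/
theorem IsAdmissibleRadius.bijective_restrict (hr : IsAdmissibleRadius T q r)
    (h₁ : Set.MapsTo T V₁ V₁) (hc : IsCompl V₁ V₂) (hq : q ∉ sSpectrum (T.restrict h₂)) {z c : ℂ}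
    (hcs : c ∈ ({⟨q.re, ‖q.im‖⟩, ⟨q.re, -‖q.im‖⟩} : Finset ℂ)) (hz : z ∈ Metric.closedBall c r) :
    Function.Bijective (pseudoResolventPoly (T.restrict h₂) z) := by
  by_cases hzq : (z : ℍ) ∈ quaternionSphere q
  · exact bijective_of_isUnit (not_not.1 (mt (mem_sSpectrum_congr hzq).1 hq))
  · exact bijective_restrict_of_notMem_sSpectrum h₁ h₂ hc (hr.notMem_sSpectrum hcs hz hzq)

variable [NormedSpace ℂ V]

/-- The factorisation makes `Q_c(T)` kill an eigenvector for `c`, so `c` lies in the `S`-spectrum of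
the restriction to `V₁`. -/
theorem mem_of_apply_eq_smul (hsm : ∀ (z : ℂ) (x : V), z • x = op (z : ℍ) • x)
    (hσ : sSpectrum (T.restrict h₁) = quaternionSphere q) {c : ℂ} {x : V}
    (hx : x ∈ V₁) (hTx : T x = c • x) (hx0 : x ≠ 0) :
    c ∈ ({⟨q.re, ‖q.im‖⟩, ⟨q.re, -‖q.im‖⟩} : Finset ℂ) := by
  rw [← coe_complex_mem_quaternionSphere_iff, ← hσ]
  intro hu
  refine hx0 (congrArg Subtype.val ((injective_iff_map_eq_zero _).1
    (bijective_of_isUnit hu).1 ⟨x, hx⟩ (Subtype.ext ?_)))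
  rw [coe_pseudoResolventPoly_restrict, ← pseudoResolventPoly_eq_factor hsm, hTx, sub_self,
    smul_zero, map_zero, sub_zero]
  rfl

theorem exists_pow_eq_zero_of_mem [Module.Finite ℍᵐᵒᵖ V₁]
    (hsm : ∀ (z : ℂ) (x : V), z • x = op (z : ℍ) • x)
    (hσ : sSpectrum (T.restrict h₁) = quaternionSphere q) {x : V} (hx : x ∈ V₁) :
    ∃ n : ℕ, (pseudoResolventPoly T q ^ n) x = 0 := by
  have := finiteDimensional_complexSubmodule hsm V₁
  refine genEigenvector_induction (T := complexOperator hsm T) (W := complexSubmodule hsm V₁)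
    (s := ({⟨q.re, ‖q.im‖⟩, ⟨q.re, -‖q.im‖⟩} : Finset ℂ)) h₁
    (fun c x hx h h0 => mem_of_apply_eq_smul hsm hσ hx h h0)
    (p := fun x => ∃ n : ℕ, (pseudoResolventPoly T q ^ n) x = 0) ⟨0, rfl⟩ ?_ ?_ hx
  · rintro x y ⟨m, hm⟩ ⟨n, hn⟩
    refine ⟨m + n, ?_⟩
    rw [map_add, pow_add, mul_apply_eq_comp, mul_apply_eq_comp, hn, map_zero, add_zero,
      ← mul_apply_eq_comp, ← pow_add, add_comm m, pow_add, mul_apply_eq_comp, hm, map_zero]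
  · intro c hc N x hx
    have h := mem_quaternionSphere_iff_norm.1 (coe_complex_mem_quaternionSphere_iff.2 hc)
    rw [← pseudoResolventPoly_congr T h.1 h.2]
    exact ⟨N, exists_pseudoResolventPoly_pow_eq_zero hsm hx⟩

variable [RightQuaternionicInner V] [CompleteSpace V] {ι : Type*}

theorem rieszProjection_apply_of_mem_left [Module.Finite ℍᵐᵒᵖ V₁]
    (hsm : ∀ (z : ℂ) (x : V), z • x = op (z : ℍ) • x)
    (b : QuaternionicHilbertBasis ι V) {I : ℍ} (hI : I ∈ imaginaryUnits)
    (hr : IsAdmissibleRadius T q r)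
    (hσ : sSpectrum (T.restrict h₁) = quaternionSphere q) {x : V} (hx : x ∈ V₁) :
    rieszProjection b T q I r x = x := by
  have := finiteDimensional_complexSubmodule hsm V₁
  have hsph : ∀ c ∈ ({⟨q.re, ‖q.im‖⟩, ⟨q.re, -‖q.im‖⟩} : Finset ℂ), ∀ z ∈ Metric.sphere c r,
      (z : ℍ) ∉ sSpectrum T := fun c hc z hz => hr.notMem_sSpectrum_of_mem_sphere hc hz
  refine genEigenvector_induction (T := complexOperator hsm T) (W := complexSubmodule hsm V₁)
    (s := ({⟨q.re, ‖q.im‖⟩, ⟨q.re, -‖q.im‖⟩} : Finset ℂ)) h₁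
    (fun c x hx h h0 => mem_of_apply_eq_smul hsm hσ hx h h0)
    (p := fun x => rieszProjection b T q I r x = x) (map_zero _) ?_ ?_ hx
  · intro x y hx hy
    rw [map_add, hx, hy]
  · intro c hc N x hx
    have h2 : (2 * Real.pi * Complex.I : ℂ) ≠ 0 := Complex.two_pi_I_ne_zero
    refine smul_right_injective V h2 ?_
    change (2 * Real.pi * Complex.I : ℂ) • _ = (2 * Real.pi * Complex.I : ℂ) • x
    rw [I_smul_rieszProjection_apply hsm b hI hr.1.le hsph]
    exact sum_circleIntegral_resolvent_of_pow_eq_zero hr.1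
      (fun c hc z hz => mem_resolventSet_complexOperator hsm (hsph c hc z hz))
      (fun c hc d hd h => notMem_closedBall_of_ne hr.2.2 hc hd h) hc hx

theorem rieszProjection_apply_of_mem_right
    (hsm : ∀ (z : ℂ) (x : V), z • x = op (z : ℍ) • x)
    (b : QuaternionicHilbertBasis ι V) {I : ℍ} (hI : I ∈ imaginaryUnits)
    (hr : IsAdmissibleRadius T q r)
    (h₁ : Set.MapsTo T V₁ V₁) (hc : IsCompl V₁ V₂)
    (hq : q ∉ sSpectrum (T.restrict h₂)) (hV₂ : IsClosed (V₂ : Set V)) {x : V} (hx : x ∈ V₂) :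
    rieszProjection b T q I r x = 0 := by
  have hsph : ∀ c ∈ ({⟨q.re, ‖q.im‖⟩, ⟨q.re, -‖q.im‖⟩} : Finset ℂ), ∀ z ∈ Metric.sphere c r,
      (z : ℍ) ∉ sSpectrum T := fun c hc z hz => hr.notMem_sSpectrum_of_mem_sphere hc hz
  have h2 : (2 * Real.pi * Complex.I : ℂ) ≠ 0 := Complex.two_pi_I_ne_zero
  refine (smul_eq_zero_iff_right h2).1 ?_
  rw [I_smul_rieszProjection_apply hsm b hI hr.1.le hsph]
  refine Finset.sum_eq_zero fun c hcs => ?_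
  refine circleIntegral_resolvent_eq_zero (T := complexOperator hsm T)
    (W := complexSubmodule hsm V₂) hV₂ h₂ hr.1
    (fun z hz => mem_resolventSet_complexOperator hsm (hsph c hcs z hz)) ?_ ?_ hx
  · intro z hz y hy h0
    have hb := hr.bijective_restrict h₁ hc hq hcs hz
    refine congrArg Subtype.val
      ((injective_iff_map_eq_zero _).1 hb.1 ⟨y, hy⟩ (Subtype.ext ?_))
    rw [coe_pseudoResolventPoly_restrict, ← pseudoResolventPoly_eq_factor hsm]
    change conj z • (z • y - complexOperator hsm T y) - T (z • y - complexOperator hsm T y) = 0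
    rw [h0, smul_zero, map_zero, sub_zero]
  · intro z hz y hy
    have hb := hr.bijective_restrict h₁ hc hq hcs hz
    obtain ⟨u, hu⟩ := hb.2 ⟨y, hy⟩
    refine ⟨conj z • (u : V) - T u, ?_, ?_⟩
    · exact (complexSubmodule hsm V₂).sub_mem ((complexSubmodule hsm V₂).smul_mem _ u.2) (h₂ u.2)
    · have h3 := pseudoResolventPoly_eq_factor' hsm T z (u : V)
      rw [← coe_pseudoResolventPoly_restrict h₂, hu] at h3
      exact h3

end Admissible

/-! ### Assembly of the proposition. -/

theorem proposition3p6 {V : Type*} [NormedAddCommGroup V] [NormedSpace ℝ V] [Module ℍᵐᵒᵖ V]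
    [IsScalarTower ℝ ℍᵐᵒᵖ V] [RightQuaternionicInner V] [CompleteSpace V]
    {ι : Type*} (b : QuaternionicHilbertBasis ι V)
    (T : V →L[ℍᵐᵒᵖ] V) (q : ℍ) (hq : q ∈ discreteSSpectrum T) :
    (∃ r : ℝ, IsAdmissibleRadius T q r) ∧
    ∀ r : ℝ, IsAdmissibleRadius T q r → ∀ I ∈ imaginaryUnits, ∀ x : V,
      x ∈ Set.range (rieszProjection b T q I r) ↔
        Tendsto (fun n : ℕ => ‖(pseudoResolventPoly T q ^ n) x‖ ^ (1 / (n : ℝ))) atTop (𝓝 0) := by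
  obtain ⟨hqT, V₁, V₂, h₁, h₂, hc, hfin, hdisj, hσ⟩ := hq
  let : NormedSpace ℂ V := rightComplexSpace
  have hsm : ∀ (z : ℂ) (x : V), z • x = op (z : ℍ) • x := fun _ _ => rfl
  have hq₂ : q ∉ sSpectrum (T.restrict h₂) := fun h =>
    Set.notMem_empty q (hdisj ▸ ⟨hσ ▸ mem_quaternionSphere_self q, h⟩)
  have hnil : ∀ x ∈ V₁, ∃ n : ℕ, (pseudoResolventPoly T q ^ n) x = 0 :=
    fun x hx => exists_pow_eq_zero_of_mem hsm hσ hx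
  have hV₂ := isClosed_of_forall_exists_pow_eq_zero hc hq₂ hnil
  refine ⟨exists_isAdmissibleRadius hc hqT hq₂ hV₂ hσ, fun r hr I hI x => ?_⟩
  rw [tendsto_norm_pow_rpow_zero_iff hc hq₂ hnil]
  constructor
  · rintro ⟨y, rfl⟩
    obtain ⟨u, hu, v, hv, rfl⟩ := Submodule.mem_sup.1
      (hc.sup_eq_top ▸ Submodule.mem_top : y ∈ V₁ ⊔ V₂)
    rw [map_add, rieszProjection_apply_of_mem_left hsm b hI hr hσ hu,
      rieszProjection_apply_of_mem_right hsm b hI hr h₁ hc hq₂ hV₂ hv, add_zero]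
    exact hu
  · exact fun hx => ⟨x, rieszProjection_apply_of_mem_left hsm b hI hr hσ hx⟩
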